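/- **Setting.** Let $\mathcal X$ be a measurable space of contexts, $\mathcal A$ a finite set of $K\ge 1$ arms and $D$ a probability law of pairs $(x,r)$, $x\in\mathcal X$, $r\in[0,1]^{\mathcal A}$, with context marginal $D_{\mathcal X}$. Let $f^*:\mathcal X\times\mathcal A\to[0,1]$, $f^*(x,a)=\mathbb E[r(a)\mid x]$, and $\pi^*(x)\in\arg\max_a f^*(x,a)$. For a probability kernel $p$ let $D(p)$ be the law of $(x,a,r(a))$ with $(x,r)\sim D$, $a\sim p(\cdot|x)$, and for a model $f:\mathcal X\times\mathcal A\to[0,1]$ let $e_p(f)=\mathbb E_{x\sim D_{\mathcal X}}\mathbb E_{a\sim p(\cdot|x)}[(f(x,a)-f^*(x,a))^2]$. For nonempty classes $\mathcal F_1,\dots,\mathcal F_M$ of models ($M\ge1$) put $b_i(p)=\inf_{f\in\mathcal F_i}e_p(f)$ and $B_i=\sup_p b_i(p)$. **Schedule.** Fix an integer $\tau_1\ge2$ and $\delta\in(0,1)$; $\tau_0=0$, $\tau_{m+1}=2\tau_m$ for $m\ge1$. Epoch $m$ consists of the rounds $\tau_{m-1}+1,\dots,\tau_m$; $n_m=\tau_m-\tau_{m-1}$,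 $\zeta_m=\delta/(4Mm^2)$, and $m(t)$ is the epoch that contains round $t$. **Rates.** Let $\xi_1,\dots,\xi_M$ be functions of $(n,\zeta)$ with values in $[0,\infty)$ that are *valid* in the following sense: $\xi_i(n,\zeta)$ is nonincreasing in $\zeta\in(0,1)$ for each $n\ge 2$; $\xi_i(n_m,\zeta_m)$ is nonincreasing in $m\ge3$; and $\xi_{i-1}(n_m,\zeta_m)\le\xi_i(n_m,\zeta_m)$ for all $m\ge1$, $1\le i\le M$, where $\xi_0(n,\zeta)=\ln(1/\zeta)/n$. Put $\gamma_{1,i}=1$ and $\gamma_{m+1,i}=\sqrt{K/(8\,\xi_i(n_m,\zeta_m))}$ for $m\ge1$. **Estimation oracle.** EstOracle maps every finite data set to a model $\hat f$, and there is $C_0\ge1$ such that for every probability kernel $p$, $n\ge2$, $\zeta\in(0,1)$, with probability at least $1-\zeta$ over $n$ i.i.d. samples from $D(p)$, its output satisfies $e_p(\hat f)\le\min_{1\le j\le M}\big(C_0b_j(p)+\xi_j(n,\zeta/M)\big)$. **Algorithm (Mod-IGW).** Let $\hat f_1\equiv0$, $\mathcal I_1=\{1,\dots,M\}$, $\gamma_1=1$.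 In each round $t$ of epoch $m$ a fresh $(x_t,r_t)\sim D$ is drawn, independent of the past, and $a_t\sim p_m(\cdot|x_t)$, where $p_m(a|x)=1/\big(K+\gamma_m(\hat f_m(x,\hat a)-\hat f_m(x,a))\big)$ for $a\ne\hat a$, with $\hat a\in\arg\max_a\hat f_m(x,a)$, and $p_m(\hat a|x)$ is the remaining mass; $r_t(a_t)$ is observed. From the data $S_m$ of epoch $m$ one forms $\hat f_{m+1}=\mathrm{EstOracle}(S_m)$, $\mathcal I_{m+1}=\{i\in\mathcal I_m:\mathrm{MTOracle}(i,S_m,\zeta_m)=\mathrm{False}\}$, $i_{m+1}=\min\mathcal I_{m+1}$ (any fixed convention, say $M$, if $\mathcal I_{m+1}=\emptyset$), and $\gamma_{m+1}=\gamma_{m+1,i_{m+1}}$. **Misspecification test.** Let $m^*_i\in\{0,1,\dots,\infty\}$ be the supremum of all $m\ge1$ with $\xi_i(n_m,\zeta_m)\ge C_0\min_{i'\le i}B_{i'}$ ($0$ if there is none), $\tau_\infty=\infty$. There are $\beta'_i\in(0,1]$ and $0=\beta_0\le\beta_1\le\dots\le\beta_M\le\infty$ with $\beta_i>\beta_i'\tau_{m^*_i}$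 or $\beta_i=\infty$, such that for all $i\in\{1,\dots,M\}$, $m\ge1$, $\zeta\in(0,1)$: if $\tau_m\le\beta_i'\tau_{m_i^*}$ then $\Pr[\mathrm{MTOracle}(i,S_m,\zeta)=\mathrm{False}]\ge1-\zeta$, and if $\tau_m>\beta_i$ then $\Pr[\mathrm{MTOracle}(i,S_m,\zeta)=\mathrm{True}]\ge1-\zeta$. **Claim.** There is an absolute constant $C$ such that, in this setting, with probability at least $1-\delta$, for all $i,j\in\{1,\dots,M\}$ with $\beta_{j-1}<\infty$ and all rounds $1\le t\le\beta_i'\tau_{m_i^*}$, $$R_t\le C\Big(\tau_1+\beta_{j-1}\,\Lambda_{i,j}+\sum_{t'=\tau_1+1}^{t}\frac{\gamma_{m(t')-1,j}}{\gamma_{m(t')-1,i}}\sqrt{K\,\xi_i\Big(\tau_{m(t')-1}-\tau_{m(t')-2},\frac{\delta}{4M\,m(t')^2}\Big)}\Big).$$ Here $\Lambda_{i,j}=\max_{1\le m\le \bar m}\ln(\gamma_{m,1}/\gamma_{m,i})$ with $\bar m=\min\{m:\tau_m>\beta_{j-1}\}$ if $j\le i$, and $\Lambda_{i,j}$ is the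 maximum of this number and $1$ if $j>i$. (If $\gamma_{m,1}/\gamma_{m,i}$ is nondecreasing in $m$, the maximum over $m$ is $\ln(\gamma_{\bar m,1}/\gamma_{\bar m,i})$.) On the same event the bound holds both for $R_t=\sum_{s=1}^t[f^*(x_s,\pi^*(x_s))-f^*(x_s,a_s)]$ and for $R_t=\sum_{s=1}^t\mathbb E_{x\sim D_{\mathcal X}}\mathbb E_{a\sim p_{m(s)}(\cdot|x)}[f^*(x,\pi^*(x))-f^*(x,a)]$, the sum of the conditional expected regrets of the rounds given the past. -/

import Mathlib

open MeasureTheory ProbabilityTheory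
open scoped ENNReal

noncomputable section

namespace ModIGW

/-- A stochastic contextual bandit: the joint law of a context and a reward vector with entries
in `[0,1]`, together with (a version of) the conditional mean reward function. -/
structure Environment (X A : Type*) [MeasurableSpace X] where
  /-- The law `D` of `(x, r)`. -/
  law : Measure (X × (A → ℝ))
  isProb : IsProbabilityMeasure law
  reward_mem : ∀ᵐ z ∂law, ∀ a, z.2 a ∈ Set.Icc (0 : ℝ) 1
  /-- The function `f*(x,a) = E[r(a) | x]`. -/
  fstar : X → A → ℝ
  fstar_measurable : Measurable fstar
  fstar_mem : ∀ x a, fstar x a ∈ Set.Icc (0 : ℝ) 1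
  fstar_condExp : ∀ a, (fun z : X × (A → ℝ) => fstar z.1 a) =ᵐ[law]
    law[(fun z : X × (A → ℝ) => z.2 a) | MeasurableSpace.comap Prod.fst inferInstance]

namespace Environment

variable {X A : Type*} [MeasurableSpace X] [MeasurableSpace A]

/-- The marginal law of the contexts. -/
def ctxLaw (E : Environment X A) : Measure X := E.law.map Prod.fst

/-- The law `D(p)` of `(x, a, r(a))`, where `(x, r) ~ D` and then `a ~ p(·|x)`. -/
def sampleLaw (E : Environment X A) (p : Kernel X A) : Measure (X × A × ℝ) :=
  (E.law ⊗ₘ (p.comap Prod.fst measurable_fst)).map (fun q => (q.1.1, q.2, q.1.2 q.2))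

/-- `E_{x ~ D_X} E_{a ~ p(·|x)} [(f(x,a) - f*(x,a))^2]`. -/
def sqErr (E : Environment X A) (p : Kernel X A) (f : X → A → ℝ) : ℝ :=
  ∫ x, ∫ a, (f x a - E.fstar x a) ^ 2 ∂(p x) ∂E.ctxLaw

/-- The misspecification error `b(p)` of a class of models under the kernel `p`. -/
def misspec (E : Environment X A) (F : Set (X → A → ℝ)) (p : Kernel X A) : ℝ :=
  ⨅ f : F, E.sqErr p f

/-- The average squared misspecification error `B`: the supremum of `b(p)` over all
probability kernels. -/
def maxMisspec (E : Environment X A) (F : Set (X → A → ℝ)) : ℝ :=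
  ⨆ p : {p : Kernel X A // IsMarkovKernel p}, E.misspec F p.1

end Environment

/-- A nonempty class of (measurable) models `X × A → [0,1]`. -/
structure IsModelClass {X A : Type*} [MeasurableSpace X] (F : Set (X → A → ℝ)) : Prop where
  nonempty : F.Nonempty
  measurable : ∀ f ∈ F, Measurable f
  mem_Icc : ∀ f ∈ F, ∀ x a, f x a ∈ Set.Icc (0 : ℝ) 1

/-- The last round `τ_m` of epoch `m`: `τ_0 = 0` and `τ_m = 2^(m-1) τ_1` for `m ≥ 1`. -/
def tau (τ₁ : ℕ) : ℕ → ℕ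
  | 0 => 0
  | m + 1 => 2 ^ m * τ₁

/-- `τ_m` for a possibly infinite `m`. -/
def tauTop (τ₁ : ℕ) : ℕ∞ → ℝ≥0∞
  | ⊤ => ⊤
  | (m : ℕ) => (tau τ₁ m : ℝ≥0∞)

/-- The length of epoch `m`. -/
def epochLen (τ₁ m : ℕ) : ℕ := tau τ₁ m - tau τ₁ (m - 1)

/-- The epoch `m(t) = min {m | t ≤ τ_m}` that contains round `t`. -/
def epochOf (τ₁ t : ℕ) : ℕ := sInf {m | t ≤ tau τ₁ m}

/-- The first epoch that ends after time `b`. -/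
def epochAfter (τ₁ : ℕ) (b : ℝ) : ℕ := sInf {m | b < (tau τ₁ m : ℝ)}

/-- The estimation rate `ξ_0` for the mean of a bounded one-dimensional random variable. -/
def xiZero (n : ℕ) (ζ : ℝ) : ℝ := Real.log (1 / ζ) / n

open Classical in
/-- Inverse gap weighting: the probability of arm `b` when the estimated rewards of the arms are
`v`, the exploration parameter is `γ`, and `argmax v` is the predicted best arm. -/
def igw {A : Type*} [Fintype A] (argmax : (A → ℝ) → A) (v : A → ℝ) (γ : ℝ) (b : A) : ℝ :=
  if b = argmax v then
    1 - ∑ a ∈ Finset.univ.erase (argmax v), 1 / (Fintype.card A + γ * (v (argmax v) - v a))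
  else 1 / (Fintype.card A + γ * (v (argmax v) - v b))

/-- The inputs of the algorithm: number `M` of classes (indexed by `1, …, M`), initial epoch
length, confidence parameter, estimation rates `ξ_i(n, ζ)`, a rule for choosing maximizers,
the estimation oracle for the whole sequence of classes, and the misspecification test
(`true` means: declared misspecified). -/
structure Learner (X A : Type*) [MeasurableSpace X] [MeasurableSpace A] where
  M : ℕ
  one_le_M : 1 ≤ M
  τ₁ : ℕ
  two_le_τ₁ : 2 ≤ τ₁
  δ : ℝ
  δ_pos : 0 < δ
  δ_lt_one : δ < 1
  ξ : ℕ → ℕ → ℝ → ℝ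
  argmax : (A → ℝ) → A
  argmax_measurable : Measurable argmax
  le_argmax : ∀ (v : A → ℝ) (a : A), v a ≤ v (argmax v)
  est : (n : ℕ) → (Fin n → X × A × ℝ) → X → A → ℝ
  est_measurable : ∀ n,
    Measurable (fun q : (Fin n → X × A × ℝ) × X => est n q.1 q.2)
  est_mem : ∀ n S x a, est n S x a ∈ Set.Icc (0 : ℝ) 1
  mt : ℕ → (n : ℕ) → (Fin n → X × A × ℝ) → ℝ → Bool
  mt_measurable : ∀ i n ζ, Measurable (fun S => mt i n S ζ)

namespace Learner

variable {X A : Type*} [MeasurableSpace X] [MeasurableSpace A]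

/-- The confidence level `δ/(4 M m^2)` used at the end of epoch `m`. -/
def conf (L : Learner X A) (m : ℕ) : ℝ := L.δ / (4 * L.M * (m : ℝ) ^ 2)

/-- `ξ_i(τ_m - τ_{m-1}, δ/(4 M m^2))`. -/
def rate (L : Learner X A) (i m : ℕ) : ℝ := L.ξ i (epochLen L.τ₁ m) (L.conf m)

/-- The exploration parameters `γ_{m,i}`, with `γ_{0,i} = γ_{1,i} = 1`. -/
def gammaIdx [Fintype A] (L : Learner X A) : ℕ → ℕ → ℝ
  | 0, _ => 1
  | 1, _ => 1
  | m + 2, i => √(Fintype.card A / (8 * L.rate i (m + 1)))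

/-- Validity of the estimation rates. Only the values along the epoch schedule are constrained
by the last three conditions; `antitone_epoch` says that `γ_{m,i}` is nondecreasing in `m ≥ 4`, and
`monotone_class` that `γ_{m,i}` is nonincreasing in `i` for `m ≥ 2`. -/
structure ValidRates (L : Learner X A) : Prop where
  nonneg : ∀ i ∈ Finset.Icc 1 L.M, ∀ n ζ, 0 < ζ → ζ < 1 → 0 ≤ L.ξ i n ζ
  antitone_conf : ∀ i ∈ Finset.Icc 1 L.M, ∀ n, 2 ≤ n → ∀ ζ ζ', 0 < ζ → ζ ≤ ζ' → ζ' < 1 →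
    L.ξ i n ζ' ≤ L.ξ i n ζ
  antitone_epoch : ∀ i ∈ Finset.Icc 1 L.M, ∀ m, 3 ≤ m → L.rate i (m + 1) ≤ L.rate i m
  xiZero_le : ∀ m, 1 ≤ m → xiZero (epochLen L.τ₁ m) (L.conf m) ≤ L.rate 1 m
  monotone_class : ∀ i, 1 ≤ i → i + 1 ≤ L.M → ∀ m, 1 ≤ m → L.rate i m ≤ L.rate (i + 1) m

/-- The guarantee of the estimation oracle over the classes `F_1, …, F_M`. -/
def EstGuarantee (L : Learner X A) (E : Environment X A) (F : ℕ → Set (X → A → ℝ))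
    (C₀ : ℝ) : Prop :=
  ∀ (p : Kernel X A), IsMarkovKernel p → ∀ n, 2 ≤ n → ∀ ζ : ℝ, 0 < ζ → ζ < 1 →
    ENNReal.ofReal (1 - ζ) ≤ (Measure.pi (fun _ : Fin n => E.sampleLaw p))
      {S | ∀ j ∈ Finset.Icc 1 L.M,
        E.sqErr p (L.est n S) ≤ C₀ * E.misspec (F j) p + L.ξ j n (ζ / L.M)}

/-- The safe epoch `m*_i`, possibly infinite (and `0` if no epoch qualifies). -/
def safeEpoch (L : Learner X A) (E : Environment X A) (F : ℕ → Set (X → A → ℝ)) (C₀ : ℝ)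
    (i : ℕ) : ℕ∞ :=
  ⨆ m ∈ {m : ℕ | 1 ≤ m ∧
    C₀ * (⨅ k : Finset.Icc 1 i, E.maxMisspec (F k)) ≤ L.rate i m}, (m : ℕ∞)

/-! The following are the quantities that the algorithm computes from the stream
`d t = (x_t, a_t, r_t(a_t))`, `t ≥ 1`, of observations. -/

/-- The data `S_m` collected in epoch `m`. -/
def epochData (L : Learner X A) (d : ℕ → X × A × ℝ) (m : ℕ) :
    Fin (epochLen L.τ₁ m) → X × A × ℝ :=
  fun k => d (tau L.τ₁ (m - 1) + 1 + k)

/-- The estimated model used in epoch `m`. -/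
def model (L : Learner X A) (d : ℕ → X × A × ℝ) : ℕ → X → A → ℝ
  | 0 => fun _ _ => 0
  | 1 => fun _ _ => 0
  | m + 2 => L.est _ (L.epochData d (m + 1))

/-- The index set used in epoch `m`. -/
def indexSet (L : Learner X A) (d : ℕ → X × A × ℝ) : ℕ → Finset ℕ
  | 0 => Finset.Icc 1 L.M
  | 1 => Finset.Icc 1 L.M
  | m + 2 => (L.indexSet d (m + 1)).filter
      (fun i => L.mt i _ (L.epochData d (m + 1)) (L.conf (m + 1)) = false)

open Classical in
/-- The smallest element of the index set (by convention `M` if the set is empty). -/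
def index (L : Learner X A) (d : ℕ → X × A × ℝ) (m : ℕ) : ℕ :=
  if h : (L.indexSet d m).Nonempty then (L.indexSet d m).min' h else L.M

/-- The exploration parameter used in epoch `m`. -/
def gamma [Fintype A] (L : Learner X A) (d : ℕ → X × A × ℝ) (m : ℕ) : ℝ :=
  L.gammaIdx m (L.index d m)

/-- The action selection kernel `p_m(b|x)` of epoch `m`. -/
def selProb [Fintype A] (L : Learner X A) (d : ℕ → X × A × ℝ) (m : ℕ) (x : X) (b : A) : ℝ :=
  igw L.argmax (L.model d m x) (L.gamma d m) b

end Learner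

/-- A run of the algorithm on a probability space: in every round `t ≥ 1` the pair
`(x_t, r_t) ~ D` is independent of the past, and given the past and `(x_t, r_t)` the arm `a_t`
is drawn from `p_{m(t)}(·|x_t)`. -/
structure Run {X A Ω : Type*} [MeasurableSpace X] [MeasurableSpace A] [Fintype A]
    [MeasurableSpace Ω] (E : Environment X A) (L : Learner X A) (P : Measure Ω) where
  x : ℕ → Ω → X
  r : ℕ → Ω → A → ℝ
  a : ℕ → Ω → A
  x_measurable : ∀ t, Measurable (x t)
  r_measurable : ∀ t, Measurable (r t)
  a_measurable : ∀ t, Measurable (a t)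
  law_eq : ∀ t, 1 ≤ t → P.map (fun ω => (x t ω, r t ω)) = E.law
  indep_past : ∀ t, 1 ≤ t → Indep
    (⨆ s ∈ Finset.Ico 1 t,
      MeasurableSpace.comap (fun ω => (x s ω, r s ω, a s ω)) inferInstance)
    (MeasurableSpace.comap (fun ω => (x t ω, r t ω)) inferInstance) P
  action_law : ∀ t, 1 ≤ t → ∀ b : A,
    P[(a t ⁻¹' {b}).indicator (fun _ => (1 : ℝ)) |
      (⨆ s ∈ Finset.Ico 1 t,
        MeasurableSpace.comap (fun ω => (x s ω, r s ω, a s ω)) inferInstance) ⊔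
      MeasurableSpace.comap (fun ω => (x t ω, r t ω)) inferInstance] =ᵐ[P]
    fun ω => L.selProb (fun s => (x s ω, a s ω, r s ω (a s ω))) (epochOf L.τ₁ t) (x t ω) b

namespace Run

variable {X A Ω : Type*} [MeasurableSpace X] [MeasurableSpace A] [Fintype A]
  [MeasurableSpace Ω] {E : Environment X A} {L : Learner X A} {P : Measure Ω}

/-- The stream of observations. -/
def obs (R : Run E L P) (ω : Ω) (t : ℕ) : X × A × ℝ := (R.x t ω, R.a t ω, R.r t ω (R.a t ω))

/-- The gap `f*(x, π*(x)) - f*(x, b)`. -/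
def gap (E : Environment X A) (L : Learner X A) (x : X) (b : A) : ℝ :=
  E.fstar x (L.argmax (E.fstar x)) - E.fstar x b

/-- The cumulative regret `R_t`. -/
def regret (R : Run E L P) (t : ℕ) (ω : Ω) : ℝ :=
  ∑ s ∈ Finset.Icc 1 t, gap E L (R.x s ω) (R.a s ω)

/-- The cumulative regret in which the regret of each round is replaced by its conditional
expectation given the past, `E_{x ~ D_X} E_{a ~ p_{m(s)}(·|x)} [f*(x, π*(x)) - f*(x, a)]`. -/
def expRegret (R : Run E L P) (t : ℕ) (ω : Ω) : ℝ :=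
  ∑ s ∈ Finset.Icc 1 t,
    ∫ x, ∑ b, L.selProb (R.obs ω) (epochOf L.τ₁ s) x b * gap E L x b ∂E.ctxLaw

/-- The assumption on the misspecification test with parameters `β'_i` and `β_i`, where
`β_0 = 0`, and `β_i` may be infinite (as it has to be when `m*_i` is infinite). -/
structure MTGuarantee (R : Run E L P) (F : ℕ → Set (X → A → ℝ)) (C₀ : ℝ)
    (β' : ℕ → ℝ) (β : ℕ → ℝ≥0∞) : Prop where
  beta_zero : β 0 = 0
  beta_mono : ∀ i, 1 ≤ i → i + 1 ≤ L.M → β i ≤ β (i + 1)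
  beta'_mem : ∀ i ∈ Finset.Icc 1 L.M, β' i ∈ Set.Ioc (0 : ℝ) 1
  beta_gt : ∀ i ∈ Finset.Icc 1 L.M,
    ENNReal.ofReal (β' i) * tauTop L.τ₁ (L.safeEpoch E F C₀ i) < β i ∨ β i = ⊤
  accepts : ∀ i ∈ Finset.Icc 1 L.M, ∀ m, 1 ≤ m → ∀ ζ : ℝ, 0 < ζ → ζ < 1 →
    (tau L.τ₁ m : ℝ≥0∞) ≤ ENNReal.ofReal (β' i) * tauTop L.τ₁ (L.safeEpoch E F C₀ i) →
    ENNReal.ofReal (1 - ζ) ≤ P {ω | L.mt i _ (L.epochData (R.obs ω) m) ζ = false}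
  rejects : ∀ i ∈ Finset.Icc 1 L.M, ∀ m, 1 ≤ m → ∀ ζ : ℝ, 0 < ζ → ζ < 1 →
    β i < (tau L.τ₁ m : ℝ≥0∞) →
    ENNReal.ofReal (1 - ζ) ≤ P {ω | L.mt i _ (L.epochData (R.obs ω) m) ζ = true}

end Run

namespace Learner

variable {X A : Type*} [MeasurableSpace X] [MeasurableSpace A] [Fintype A]

/-- The largest value of `ln(γ_{m,1}/γ_{m,i})` over the epochs `m` up to the first one that ends
after time `b`. -/
def maxLogRatio (L : Learner X A) (b : ℝ) (i : ℕ) : ℝ :=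
  ⨆ m : Finset.Icc 1 (epochAfter L.τ₁ b), Real.log (L.gammaIdx m 1 / L.gammaIdx m i)

/-- The logarithmic factor of the bound: `maxLogRatio`, and for `j > i` at least `1`. -/
def logFactor (L : Learner X A) (b : ℝ) (i j : ℕ) : ℝ :=
  if j ≤ i then L.maxLogRatio b i else max 1 (L.maxLogRatio b i)

/-- The sum over the rounds `s = τ_1 + 1, …, t` of
`γ_{m(s)-1,j}/γ_{m(s)-1,i} * √(K ξ_i(τ_{m(s)-1} - τ_{m(s)-2}, δ/(4 M m(s)^2)))`. -/
def rateSum (L : Learner X A) (i j t : ℕ) : ℝ :=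
  ∑ s ∈ Finset.Icc (L.τ₁ + 1) t,
    L.gammaIdx (epochOf L.τ₁ s - 1) j / L.gammaIdx (epochOf L.τ₁ s - 1) i *
      √(Fintype.card A * L.ξ i (epochLen L.τ₁ (epochOf L.τ₁ s - 1)) (L.conf (epochOf L.τ₁ s)))

end Learner

end ModIGW

end

/-! Inverse gap weighting plays every arm with probability at least `1 / (K + γ * estimated gap)`. A
small squared error of the next model under this sampling therefore controls its error on each
single arm, at a price that grows with the estimated gap of that arm. By AM-GM this gives, at each
fixed context, a two-sided comparison: true and estimated gaps agree up to a factor 2 and an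
additive discrepancy. One epoch divides the discrepancy by 4 and adds a term of order `K/γ` plus `γ`
times the local squared error (`gap_comparison_step`). No monotonicity of the parameters actually
used is needed, and the recursion may start in any epoch with discrepancy 1. Epoch lengths only
double, so the starting discrepancy, weighted by length, decays geometrically and costs a multiple
of the time at which the recursion starts (`sum_epochRegret_le`).

Fix `i` and a round `t` in its safe range. If `j > i`, then `t ≤ β_{j-1}` and the trivial bound `t`
suffices. If `j ≤ i`, all tests so far have kept `i`, so `γ_m ≥ γ_{m,i}`, and the squared errors are
at most `2 ξ_i`, because `C₀ B_k ≤ ξ_i` for some `k ≤ i`. The recursion yields the claimed sum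
wherever `γ_m ≤ 3 γ_{m,j}`. This holds once `β_{j-1}` has passed and all classes below `j` are
rejected; waiting for that costs `O(τ₁ + β_{j-1})`, which is affordable if the log ratio `Λ` is at
least 1. If `Λ < 1`, then `γ_m ≤ γ_{m,1} < e γ_{m,i} ≤ 3 γ_{m,j}` already during the waiting time,
and no waiting is needed. This dichotomy produces the term `β_{j-1} Λ` (`Run.max_regret_le`).

For the probability of the good event: given the earlier epochs, the data of an epoch are i.i.d.
from `D(p_m)` (`lintegral_block`), so the oracle guarantee applies conditionally. A stopped
exponential supermartingale (`measure_exists_sum_gt_le`) passes from expected to realised regret,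
and its deviation is absorbed by the rate sum because `ξ_i ≥ ξ_0` (`sqrt_tau_mul_log_le`). -/

namespace ModIGW

/-! ### Arithmetic of the doubling epoch schedule. -/

section Schedule

lemma tau_succ_succ (τ₁ m : ℕ) : tau τ₁ (m + 2) = 2 * tau τ₁ (m + 1) := by
  simp only [tau, pow_succ]; ring

lemma tau_one (τ₁ : ℕ) : tau τ₁ 1 = τ₁ := by simp [tau]

lemma tau_mono (τ₁ : ℕ) : Monotone (tau τ₁) := by
  refine monotone_nat_of_le_succ fun m => ?_
  cases m with
  | zero => simp [tau]
  | succ m => rw [tau_succ_succ]; omega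

lemma tau_strictMono {τ₁ : ℕ} (h : 2 ≤ τ₁) : StrictMono (tau τ₁) := by
  refine strictMono_nat_of_lt_succ fun m => ?_
  have hp : 0 < tau τ₁ (m + 1) := by simp only [tau]; positivity
  cases m with
  | zero => simpa [tau] using hp
  | succ m =>
    rw [tau_succ_succ]
    have : 0 < tau τ₁ (m + 1) := by simp only [tau]; positivity
    omega

lemma le_tau {τ₁ : ℕ} (h : 2 ≤ τ₁) (m : ℕ) : m ≤ tau τ₁ m := (tau_strictMono h).le_apply

lemma le_tau_epochOf {τ₁ : ℕ} (h : 2 ≤ τ₁) (t : ℕ) : t ≤ tau τ₁ (epochOf τ₁ t) :=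
  Nat.sInf_mem (s := {m | t ≤ tau τ₁ m}) ⟨t, le_tau h t⟩

lemma epochOf_le {τ₁ t m : ℕ} (h : t ≤ tau τ₁ m) : epochOf τ₁ t ≤ m := Nat.sInf_le h

lemma epochOf_pos {τ₁ t : ℕ} (h : 2 ≤ τ₁) (ht : 1 ≤ t) : 1 ≤ epochOf τ₁ t := by
  by_contra hc
  have h0 : epochOf τ₁ t = 0 := by omega
  have := le_tau_epochOf h t
  rw [h0] at this
  simp [tau] at this
  omega

lemma tau_epochOf_lt {τ₁ t : ℕ} (h : 2 ≤ τ₁) (ht : 1 ≤ t) : tau τ₁ (epochOf τ₁ t - 1) < t := by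
  by_contra hc
  have := epochOf_le (not_lt.mp hc)
  have := epochOf_pos h ht
  omega

lemma epochOf_eq {τ₁ t m : ℕ} (h : 2 ≤ τ₁) (h1 : tau τ₁ m < t) (h2 : t ≤ tau τ₁ (m + 1)) :
    epochOf τ₁ t = m + 1 := by
  refine le_antisymm (epochOf_le h2) ?_
  have h3 := lt_of_lt_of_le h1 (le_tau_epochOf h t)
  exact (tau_strictMono h).lt_iff_lt.mp h3

lemma epochLen_one (τ₁ : ℕ) : epochLen τ₁ 1 = τ₁ := by simp [epochLen, tau]

lemma epochLen_succ_succ (τ₁ m : ℕ) : epochLen τ₁ (m + 2) = tau τ₁ (m + 1) := by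
  simp only [epochLen, Nat.add_succ_sub_one, tau_succ_succ]; omega

lemma two_le_epochLen {τ₁ m : ℕ} (h : 2 ≤ τ₁) (hm : 1 ≤ m) : 2 ≤ epochLen τ₁ m := by
  obtain _ | _ | m := m
  · omega
  · simpa [epochLen_one] using h
  · rw [epochLen_succ_succ]
    calc 2 ≤ tau τ₁ 1 := by simpa [tau_one] using h
      _ ≤ _ := tau_mono _ (by omega)

lemma tau_add_epochLen (τ₁ m : ℕ) : tau τ₁ m + epochLen τ₁ (m + 1) = tau τ₁ (m + 1) := by
  have := tau_mono τ₁ (Nat.le_succ m)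
  simp only [epochLen, Nat.add_sub_cancel, Nat.succ_eq_add_one] at *
  omega

lemma lt_tau_epochAfter {τ₁ : ℕ} (h : 2 ≤ τ₁) (b : ℝ) : b < tau τ₁ (epochAfter τ₁ b) := by
  refine Nat.sInf_mem (s := {m | b < (tau τ₁ m : ℝ)}) ?_
  obtain ⟨n, hn⟩ := exists_nat_gt b
  exact ⟨n, hn.trans_le (by exact_mod_cast le_tau h n)⟩

lemma epochAfter_pos {τ₁ : ℕ} (h : 2 ≤ τ₁) {b : ℝ} (hb : 0 ≤ b) : 1 ≤ epochAfter τ₁ b := by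
  by_contra hc
  have h0 : epochAfter τ₁ b = 0 := by omega
  have := lt_tau_epochAfter h b
  rw [h0] at this
  simp [tau] at this
  linarith

/-- By minimality the epoch before `epochAfter` ends by time `b`, and two doublings give `4 * b`;
the summand `2 * τ₁` covers the case that the first epoch already ends after `b`. The additional
epoch is the first one in which the rejections after time `b` take effect. -/
lemma tau_epochAfter_add_one_le {τ₁ : ℕ} (h : 2 ≤ τ₁) {b : ℝ} (hb : 0 ≤ b) :
    (tau τ₁ (epochAfter τ₁ b + 1) : ℝ) ≤ 2 * τ₁ + 4 * b := by
  have h1 := epochAfter_pos h hb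
  obtain ⟨k, hk⟩ : ∃ k, epochAfter τ₁ b = k + 1 := ⟨_, (Nat.succ_pred_eq_of_pos h1).symm⟩
  rw [hk, tau_succ_succ]
  cases k with
  | zero => push_cast [tau_one]; linarith
  | succ k =>
    have hlt : (tau τ₁ (k + 1) : ℝ) ≤ b := by
      by_contra hc
      have := Nat.sInf_le (s := {m | b < (tau τ₁ m : ℝ)}) (not_le.mp hc)
      change epochAfter τ₁ b ≤ _ at this
      omega
    rw [tau_succ_succ]
    push_cast
    have : (0 : ℝ) ≤ τ₁ := Nat.cast_nonneg _
    linarith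

end Schedule

/-! ### Confidence levels, estimation rates and exploration parameters. -/

namespace Learner

variable {X A : Type*} [MeasurableSpace X] [MeasurableSpace A] (L : Learner X A)

lemma conf_pos {m : ℕ} (hm : 1 ≤ m) : 0 < L.conf m := by
  have h1 : (0 : ℝ) < m := by exact_mod_cast hm
  have h2 : (0 : ℝ) < L.M := by exact_mod_cast L.one_le_M
  have h3 := L.δ_pos
  unfold conf; positivity

lemma conf_antitone {m m' : ℕ} (hm : 1 ≤ m) (h : m ≤ m') : L.conf m' ≤ L.conf m := by
  have h1 : (0 : ℝ) < m := by exact_mod_cast hm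
  have h2 : (0 : ℝ) < L.M := by exact_mod_cast L.one_le_M
  have h3 := L.δ_pos
  have h4 : (m : ℝ) ≤ m' := by exact_mod_cast h
  unfold conf
  gcongr

/-- The constant `1 / 4` is used in `sqrt_tau_mul_log_le`, where it turns a quarter of a confidence
level into a bound by its square. -/
lemma conf_lt {m : ℕ} (hm : 1 ≤ m) : L.conf m < 1 / 4 := by
  have h1 : (1 : ℝ) ≤ m := by exact_mod_cast hm
  have h2 : (1 : ℝ) ≤ L.M := by exact_mod_cast L.one_le_M
  have h3 := L.δ_lt_one
  unfold conf
  rw [div_lt_iff₀ (by positivity)]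
  have : (1 : ℝ) ≤ L.M * (m : ℝ) ^ 2 := by nlinarith [one_le_pow₀ h1 (n := 2)]
  nlinarith

lemma conf_lt_one {m : ℕ} (hm : 1 ≤ m) : L.conf m < 1 := (L.conf_lt hm).trans (by norm_num)

variable {L}

lemma xiZero_pos {m : ℕ} (hm : 1 ≤ m) : 0 < xiZero (epochLen L.τ₁ m) (L.conf m) := by
  unfold xiZero
  have h1 := L.conf_pos hm
  have h2 := L.conf_lt_one hm
  have h3 := two_le_epochLen L.two_le_τ₁ hm
  refine div_pos (Real.log_pos ?_) (by positivity)
  rw [lt_div_iff₀ h1]; linarith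

namespace ValidRates

variable (hL : L.ValidRates)
include hL

lemma rate_mono_class {i j m : ℕ} (hi : 1 ≤ i) (hij : i ≤ j) (hj : j ≤ L.M) (hm : 1 ≤ m) :
    L.rate i m ≤ L.rate j m := by
  induction j, hij using Nat.le_induction with
  | base => exact le_rfl
  | succ k hk ih => exact (ih (by omega)).trans (hL.monotone_class k (by omega) hj m hm)

lemma xiZero_le_rate {i m : ℕ} (hi : i ∈ Finset.Icc 1 L.M) (hm : 1 ≤ m) :
    xiZero (epochLen L.τ₁ m) (L.conf m) ≤ L.rate i m := by
  rw [Finset.mem_Icc] at hi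
  exact (hL.xiZero_le m hm).trans (hL.rate_mono_class le_rfl hi.1 hi.2 hm)

lemma rate_pos {i m : ℕ} (hi : i ∈ Finset.Icc 1 L.M) (hm : 1 ≤ m) : 0 < L.rate i m :=
  (xiZero_pos hm).trans_le (hL.xiZero_le_rate hi hm)

lemma rate_antitone_epoch {i m m' : ℕ} (hi : i ∈ Finset.Icc 1 L.M) (hm : 3 ≤ m) (h : m ≤ m') :
    L.rate i m' ≤ L.rate i m := by
  induction m', h using Nat.le_induction with
  | base => exact le_rfl
  | succ k hk ih => exact (hL.antitone_epoch i hi k (by omega)).trans ih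

lemma rate_le_xi {i m m' : ℕ} (hi : i ∈ Finset.Icc 1 L.M) (hm : 1 ≤ m) (h : m ≤ m') :
    L.rate i m ≤ L.ξ i (epochLen L.τ₁ m) (L.conf m') :=
  hL.antitone_conf i hi _ (two_le_epochLen L.two_le_τ₁ hm) _ _ (L.conf_pos (hm.trans h))
    (L.conf_antitone hm h) (L.conf_lt_one hm)

variable [Fintype A] [Nonempty A]

lemma gammaIdx_pos {i m : ℕ} (hi : i ∈ Finset.Icc 1 L.M) : 0 < L.gammaIdx m i := by
  obtain _ | _ | m := m
  · simp [gammaIdx]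
  · simp [gammaIdx]
  · have := hL.rate_pos hi (m := m + 1) (by omega)
    have hK : (0 : ℝ) < Fintype.card A := by exact_mod_cast Fintype.card_pos
    simp only [gammaIdx]
    positivity

lemma gammaIdx_antitone_class {i j m : ℕ} (hi : 1 ≤ i) (hij : i ≤ j) (hj : j ≤ L.M) :
    L.gammaIdx m j ≤ L.gammaIdx m i := by
  obtain _ | _ | m := m
  · simp [gammaIdx]
  · simp [gammaIdx]
  · have h1 := hL.rate_pos (i := i) (m := m + 1) (Finset.mem_Icc.mpr ⟨hi, by omega⟩) (by omega)
    have h2 := hL.rate_mono_class hi hij hj (m := m + 1) (by omega)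
    simp only [gammaIdx]
    gcongr

lemma gammaIdx_mono_epoch {i m : ℕ} (hi : i ∈ Finset.Icc 1 L.M) (hm : 4 ≤ m) :
    L.gammaIdx m i ≤ L.gammaIdx (m + 1) i := by
  obtain ⟨m, rfl⟩ := Nat.exists_eq_add_of_le' (show 2 ≤ m by omega)
  have h1 := hL.rate_pos hi (m := m + 1 + 1) (by omega)
  have h2 := hL.antitone_epoch i hi (m + 1) (by omega)
  simp only [gammaIdx]
  gcongr

lemma gammaIdx_sq {i m : ℕ} (hi : i ∈ Finset.Icc 1 L.M) :
    8 * L.rate i (m + 1) * L.gammaIdx (m + 2) i ^ 2 = Fintype.card A := by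
  have h1 := hL.rate_pos hi (m := m + 1) (by omega)
  have hK : (0 : ℝ) < Fintype.card A := by exact_mod_cast Fintype.card_pos
  simp only [gammaIdx]
  rw [Real.sq_sqrt (by positivity)]
  field_simp

/-- The inverse of `γ_{m,i}` in terms of the rate. -/
lemma card_div_gammaIdx_le {i m m' : ℕ} (hi : i ∈ Finset.Icc 1 L.M) (h : m + 1 ≤ m') :
    Fintype.card A / L.gammaIdx (m + 2) i ≤
      3 * √(Fintype.card A * L.ξ i (epochLen L.τ₁ (m + 1)) (L.conf m')) := by
  have h1 := hL.rate_pos hi (m := m + 1) (by omega)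
  have h2 := hL.rate_le_xi hi (m := m + 1) (by omega) h
  have hK : (0 : ℝ) < Fintype.card A := by exact_mod_cast Fintype.card_pos
  have hg := hL.gammaIdx_pos hi (m := m + 2)
  have hs := hL.gammaIdx_sq hi (m := m)
  refine (abs_le_of_sq_le_sq' (b := 3 * √(Fintype.card A * L.ξ i (epochLen L.τ₁ (m + 1))
    (L.conf m'))) ?_ (by positivity)).2
  -- Since `K / γ = √(8 K ξ)`, the factor 3 is just `8 ≤ 9`.
  rw [mul_pow, Real.sq_sqrt (by nlinarith), div_pow, div_le_iff₀ (by positivity)]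
  nlinarith [mul_pos hK (pow_pos hg 2),
    mul_le_mul_of_nonneg_left h2 (mul_pos hK (pow_pos hg 2)).le]

end ValidRates

section LogRatio

variable [Fintype A]

lemma le_maxLogRatio {i m : ℕ} {b : ℝ} (hm : 1 ≤ m) (h : m ≤ epochAfter L.τ₁ b) :
    Real.log (L.gammaIdx m 1 / L.gammaIdx m i) ≤ L.maxLogRatio b i :=
  le_ciSup (f := fun m : Finset.Icc 1 (epochAfter L.τ₁ b) =>
    Real.log (L.gammaIdx m 1 / L.gammaIdx m i)) (Set.finite_range _).bddAbove
    ⟨m, Finset.mem_Icc.mpr ⟨hm, h⟩⟩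

variable (L) in
-- Epoch 1 contributes `log (1 / 1) = 0` to the maximum.
lemma maxLogRatio_nonneg (i : ℕ) {b : ℝ} (hb : 0 ≤ b) : 0 ≤ L.maxLogRatio b i := by
  have := L.le_maxLogRatio (i := i) (b := b) le_rfl (epochAfter_pos L.two_le_τ₁ hb)
  simpa [gammaIdx] using this

end LogRatio

end Learner

/-! ### Inverse gap weighting at one fixed context. -/

section InverseGapWeighting

lemma gap_nonneg {A : Type*} {argmax : (A → ℝ) → A}
    (h : ∀ (v : A → ℝ) (a : A), v a ≤ v (argmax v)) (v : A → ℝ) (b : A) :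
    0 ≤ v (argmax v) - v b := sub_nonneg.mpr (h v b)

variable {A : Type*} [Fintype A] {argmax : (A → ℝ) → A}

open Classical in
lemma sum_igw (v : A → ℝ) (γ : ℝ) : ∑ b, igw argmax v γ b = 1 := by
  have hs : ∑ a ∈ Finset.univ.erase (argmax v), igw argmax v γ a =
      ∑ a ∈ Finset.univ.erase (argmax v), 1 / (Fintype.card A + γ * (v (argmax v) - v a)) :=
    Finset.sum_congr rfl fun a ha => by rw [igw, if_neg (Finset.ne_of_mem_erase ha)]
  rw [← Finset.add_sum_erase _ _ (Finset.mem_univ (argmax v)), hs, igw, if_pos rfl]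
  exact sub_add_cancel _ _

-- Each of the other `K - 1` arms receives at most `1 / K`, so the greedy arm keeps at least `1 /
-- K`. Its own gap is zero, hence one formula serves all arms.
open Classical in
lemma inv_le_igw [Nonempty A] (h : ∀ (v : A → ℝ) (a : A), v a ≤ v (argmax v)) (v : A → ℝ)
    {γ : ℝ} (hγ : 0 ≤ γ) (b : A) :
    1 / (Fintype.card A + γ * (v (argmax v) - v b)) ≤ igw argmax v γ b := by
  have hK : (0 : ℝ) < Fintype.card A := by exact_mod_cast Fintype.card_pos
  rw [igw]
  split_ifs with hb
  · subst hb
    have h1 : ∑ a ∈ Finset.univ.erase (argmax v),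
        1 / (Fintype.card A + γ * (v (argmax v) - v a)) ≤
        ∑ a ∈ Finset.univ.erase (argmax v), 1 / (Fintype.card A : ℝ) := by
      refine Finset.sum_le_sum fun a _ => ?_
      have := mul_nonneg hγ (gap_nonneg h v a)
      gcongr
      linarith
    have h2 : ∑ a ∈ Finset.univ.erase (argmax v), 1 / (Fintype.card A : ℝ) =
        1 - 1 / Fintype.card A := by
      rw [Finset.sum_const, Finset.card_erase_of_mem (Finset.mem_univ _), Finset.card_univ,
        nsmul_eq_mul, Nat.cast_pred Fintype.card_pos]
      field_simp
    rw [sub_self, mul_zero, add_zero]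
    linarith
  · exact le_rfl

lemma igw_pos [Nonempty A] (h : ∀ (v : A → ℝ) (a : A), v a ≤ v (argmax v)) (v : A → ℝ)
    {γ : ℝ} (hγ : 0 ≤ γ) (b : A) : 0 < igw argmax v γ b := by
  have hK : (0 : ℝ) < Fintype.card A := by exact_mod_cast Fintype.card_pos
  have := mul_nonneg hγ (gap_nonneg h v b)
  exact lt_of_lt_of_le (by positivity) (inv_le_igw h v hγ b)

lemma igw_le_one [Nonempty A] (h : ∀ (v : A → ℝ) (a : A), v a ≤ v (argmax v)) (v : A → ℝ)
    {γ : ℝ} (hγ : 0 ≤ γ) (b : A) : igw argmax v γ b ≤ 1 := by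
  rw [← sum_igw (argmax := argmax) v γ]
  exact Finset.single_le_sum (fun a _ => (igw_pos h v hγ a).le) (Finset.mem_univ b)

/-- The regret of inverse gap weighting under the model that defines it. -/
lemma sum_igw_mul_gap_le (h : ∀ (v : A → ℝ) (a : A), v a ≤ v (argmax v)) (v : A → ℝ)
    {γ : ℝ} (hγ : 0 < γ) :
    ∑ b, igw argmax v γ b * (v (argmax v) - v b) ≤ Fintype.card A / γ := by
  calc ∑ b, igw argmax v γ b * (v (argmax v) - v b) ≤ ∑ _b : A, 1 / γ := by
        refine Finset.sum_le_sum fun b _ => ?_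
        by_cases hb : b = argmax v
        · rw [← hb, sub_self, mul_zero]; positivity
        · rw [igw, if_neg hb]
          have h1 := gap_nonneg h v b
          have hK : (0 : ℝ) < Fintype.card A := by
            exact_mod_cast Fintype.card_pos_iff.mpr ⟨b⟩
          rw [div_mul_eq_mul_div, one_mul, div_le_div_iff₀ (by positivity) hγ]
          linarith
    _ = Fintype.card A / γ := by
        rw [Finset.sum_const, Finset.card_univ, nsmul_eq_mul, mul_one_div]

/-- One step of the comparison between true gaps and estimated gaps. Here `w` is the true reward
vector, `v` the estimate that defines the sampling probabilities and `v'` the new estimate. -/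
lemma gap_comparison_step [Nonempty A] (h : ∀ (v : A → ℝ) (a : A), v a ≤ v (argmax v))
    (w v v' : A → ℝ) {γ g a D a' : ℝ} (hγ : 0 < γ) (hg : 0 < g) (ha : 0 ≤ a)
    (hD : D = ∑ b, igw argmax v γ b * (v' b - w b) ^ 2)
    (ha' : a' = a / 4 + (Fintype.card A / (5 * (γ + g)) + 20 * (γ + g) * D))
    (H : ∀ b, v (argmax v) - v b ≤ 2 * (w (argmax w) - w b) + a ∧
      w (argmax w) - w b ≤ 2 * (v (argmax v) - v b) + a) :
    ∀ b, v' (argmax v') - v' b ≤ 2 * (w (argmax w) - w b) + a' ∧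
      w (argmax w) - w b ≤ 2 * (v' (argmax v') - v' b) + a' := by
  have hK : (0 : ℝ) < Fintype.card A := by exact_mod_cast Fintype.card_pos
  -- The weight `γ + g` works for any ratio of `γ` and `g`: `γ / (γ + g) ≤ 1` keeps the coefficient
  -- of the estimated gap at `1 / 20`, and `K / (γ + g) ≤ K / g` keeps the additive part small even
  -- if `γ` is small.
  set e : ℝ := Fintype.card A / (20 * (γ + g)) + 5 * (γ + g) * D with he
  have hDnn : 0 ≤ D := hD ▸ Finset.sum_nonneg fun b _ =>
    mul_nonneg (igw_pos h v hγ.le b).le (sq_nonneg _)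
  have he0 : 0 ≤ e := by positivity
  have hae : a' = a / 4 + 4 * e := by rw [ha', he]; field_simp; ring
  -- For a single arm, AM-GM bounds the error `y` by `1 / (20 (γ + g) p) + 5 (γ + g) p y²`; here `p
  -- y² ≤ D`, and `1 / p ≤ K + γ u` brings in the estimated gap `u`.
  have key : ∀ b, |v' b - w b| ≤ (v (argmax v) - v b) / 20 + e := by
    intro b
    set u := v (argmax v) - v b with hu
    have hu0 : 0 ≤ u := gap_nonneg h v b
    set p := igw argmax v γ b
    have hp : 0 < p := igw_pos h v hγ.le b
    have hpl : 1 / (Fintype.card A + γ * u) ≤ p := inv_le_igw h v hγ.le b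
    have hpD : p * (v' b - w b) ^ 2 ≤ D := by
      rw [hD]
      exact Finset.single_le_sum (f := fun b => igw argmax v γ b * (v' b - w b) ^ 2)
        (fun b _ => mul_nonneg (igw_pos h v hγ.le b).le (sq_nonneg _)) (Finset.mem_univ b)
    have hV : 1 / p ≤ Fintype.card A + γ * u := by
      rw [div_le_iff₀ hp]
      rw [div_le_iff₀ (by positivity)] at hpl
      linarith
    have h1 : |v' b - w b| ≤ 1 / p / (20 * (γ + g)) + 5 * (γ + g) * (p * (v' b - w b) ^ 2) := by
      rw [← sq_abs]
      set y := |v' b - w b|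
      have h2 : 1 / p / (20 * (γ + g)) + 5 * (γ + g) * (p * y ^ 2) - y =
          (10 * (γ + g) * p * y - 1) ^ 2 / (20 * (γ + g) * p) := by
        field_simp; ring
      have : 0 ≤ (10 * (γ + g) * p * y - 1) ^ 2 / (20 * (γ + g) * p) := by positivity
      linarith
    have h3 : 1 / p / (20 * (γ + g)) ≤ Fintype.card A / (20 * (γ + g)) + u / 20 := by
      calc 1 / p / (20 * (γ + g)) ≤ (Fintype.card A + γ * u) / (20 * (γ + g)) := by gcongr
        _ ≤ _ := by
          rw [div_add_div _ _ (by positivity) (by norm_num), div_le_div_iff₀ (by positivity)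
            (by positivity)]
          nlinarith [mul_nonneg hu0 (mul_nonneg hg.le hg.le),
            mul_nonneg hu0 (mul_nonneg hγ.le hg.le)]
    have h4 : 5 * (γ + g) * (p * (v' b - w b) ^ 2) ≤ 5 * (γ + g) * D := by gcongr
    rw [he]; linarith
  have hstar : v (argmax v) - v (argmax w) ≤ a := by
    have := (H (argmax w)).1
    linarith
  -- Arm `b` is compared with the true best arm. By `H` the two estimation errors sum to at most `(2
  -- * gap + a) / 20 + a / 20 + 2 * e`; the tenth of the true gap moves to the left.
  have second : ∀ b, 9 / 10 * (w (argmax w) - w b) ≤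
      (v' (argmax v') - v' b) + a / 10 + 2 * e := by
    intro b
    have h1 := abs_le.mp (key b)
    have h2 := abs_le.mp (key (argmax w))
    have h3 := h v' (argmax w)
    have h4 := (H b).1
    linarith
  intro b
  have hb' := gap_nonneg h v' b
  have hbw := gap_nonneg h w b
  refine ⟨?_, ?_⟩
  · have h1 := abs_le.mp (key b)
    have h2 := abs_le.mp (key (argmax v'))
    have h3 := h w (argmax v')
    have h4 := (H b).1
    have h5 := (H (argmax v')).1
    have h6 := second (argmax v')
    linarith
  · have := second b
    linarith

/-- The regret of inverse gap weighting with respect to the true reward vector `w`. -/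
lemma sum_igw_mul_true_gap_le [Nonempty A] (h : ∀ (v : A → ℝ) (a : A), v a ≤ v (argmax v))
    (w v : A → ℝ) {γ a : ℝ} (hγ : 0 < γ)
    (H : ∀ b, w (argmax w) - w b ≤ 2 * (v (argmax v) - v b) + a) :
    ∑ b, igw argmax v γ b * (w (argmax w) - w b) ≤ 2 * (Fintype.card A / γ) + a := by
  calc ∑ b, igw argmax v γ b * (w (argmax w) - w b)
      ≤ ∑ b, igw argmax v γ b * (2 * (v (argmax v) - v b) + a) :=
        Finset.sum_le_sum fun b _ => mul_le_mul_of_nonneg_left (H b) (igw_pos h v hγ.le b).le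
    _ = 2 * (∑ b, igw argmax v γ b * (v (argmax v) - v b)) + a * ∑ b, igw argmax v γ b := by
        rw [Finset.mul_sum, Finset.mul_sum, ← Finset.sum_add_distrib]
        exact Finset.sum_congr rfl fun b _ => by ring
    _ ≤ _ := by
        rw [sum_igw, mul_one]
        have := sum_igw_mul_gap_le h v hγ
        linarith

variable [MeasurableSpace A] [MeasurableSingletonClass A]

-- The maximizer is made a separate variable in the finite type `A`. For each fixed value the
-- formula is measurable in the rest, and the measurable rule `argmax` is substituted afterwards.
open Classical in
lemma measurable_igw (hm : Measurable argmax) (b : A) :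
    Measurable fun q : (A → ℝ) × ℝ => igw argmax q.1 q.2 b := by
  let G : A × ((A → ℝ) × ℝ) → ℝ := fun z =>
    if b = z.1 then
      1 - ∑ a ∈ Finset.univ.erase z.1, 1 / (Fintype.card A + z.2.2 * (z.2.1 z.1 - z.2.1 a))
    else 1 / (Fintype.card A + z.2.2 * (z.2.1 z.1 - z.2.1 b))
  have hG : Measurable G := by
    refine measurable_from_prod_countable_right fun c => ?_
    by_cases hb : b = c
    · simp only [G, hb, if_true]; fun_prop
    · simp only [G, hb, if_false]; fun_prop
  have : Measurable fun q : (A → ℝ) × ℝ => (argmax q.1, q) :=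
    (hm.comp measurable_fst).prodMk measurable_id
  exact hG.comp this

end InverseGapWeighting

/-! ### Locality, range and measurability of what the algorithm computes. -/

namespace Learner

variable {X A : Type*} [MeasurableSpace X] [MeasurableSpace A] (L : Learner X A)

section Locality

variable {d d' : ℕ → X × A × ℝ} {m : ℕ}

lemma epochData_congr (hm : 1 ≤ m) (h : ∀ s, 1 ≤ s → s ≤ tau L.τ₁ m → d s = d' s) :
    L.epochData d m = L.epochData d' m := by
  obtain ⟨m, rfl⟩ := Nat.exists_eq_add_of_le' hm
  funext k
  refine h _ (by omega) ?_
  have h1 := tau_add_epochLen L.τ₁ m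
  have h2 := k.2
  simp only [Nat.add_sub_cancel]
  omega

lemma model_congr (h : ∀ s, 1 ≤ s → s ≤ tau L.τ₁ (m - 1) → d s = d' s) :
    L.model d m = L.model d' m := by
  obtain _ | _ | m := m
  · rfl
  · rfl
  · simp only [model, L.epochData_congr (m := m + 1) (by omega) h]

lemma indexSet_congr (h : ∀ s, 1 ≤ s → s ≤ tau L.τ₁ (m - 1) → d s = d' s) :
    L.indexSet d m = L.indexSet d' m := by
  induction m with
  | zero => rfl
  | succ m ih =>
    cases m with
    | zero => rfl
    | succ m =>
      have h1 : L.indexSet d (m + 1) = L.indexSet d' (m + 1) :=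
        ih fun s hs hs' => h s hs (hs'.trans (tau_mono _ (by omega)))
      simp only [indexSet, L.epochData_congr (m := m + 1) (by omega) h, h1]

/-- Epoch `m` depends only on data up to the end of epoch `m - 1`. Hence the stream can later be
replaced by a frozen version that is measurable with respect to the past. -/
lemma selProb_congr [Fintype A] (h : ∀ s, 1 ≤ s → s ≤ tau L.τ₁ (m - 1) → d s = d' s) :
    L.selProb d m = L.selProb d' m := by
  funext x b
  simp only [selProb, gamma, index, L.model_congr h, L.indexSet_congr h]

end Locality

section Basic

variable (d : ℕ → X × A × ℝ) (m : ℕ)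

lemma indexSet_subset : L.indexSet d m ⊆ Finset.Icc 1 L.M := by
  induction m with
  | zero => exact subset_rfl
  | succ m ih =>
    cases m with
    | zero => exact subset_rfl
    | succ m => exact (Finset.filter_subset _ _).trans ih

lemma index_mem : L.index d m ∈ Finset.Icc 1 L.M := by
  unfold index
  split_ifs with h
  · exact L.indexSet_subset d m (Finset.min'_mem _ h)
  · exact Finset.mem_Icc.mpr ⟨L.one_le_M, le_rfl⟩

lemma index_le {i : ℕ} (hi : i ∈ L.indexSet d m) : L.index d m ≤ i := by
  rw [index, dif_pos ⟨i, hi⟩]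
  exact Finset.min'_le _ _ hi

lemma le_index {j : ℕ} (hne : (L.indexSet d m).Nonempty) (h : ∀ i ∈ L.indexSet d m, j ≤ i) :
    j ≤ L.index d m := by
  rw [index, dif_pos hne]
  exact Finset.le_min' _ _ _ h

lemma model_mem_Icc (x : X) (a : A) : L.model d m x a ∈ Set.Icc (0 : ℝ) 1 := by
  obtain _ | _ | m := m
  · simp [model]
  · simp [model]
  · exact L.est_mem _ _ _ _

variable [Fintype A]

lemma gammaIdx_nonneg (i : ℕ) : 0 ≤ L.gammaIdx m i := by
  obtain _ | _ | m := m
  · simp [gammaIdx]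
  · simp [gammaIdx]
  · exact Real.sqrt_nonneg _

lemma gamma_nonneg : 0 ≤ L.gamma d m := L.gammaIdx_nonneg _ _

lemma sum_selProb (x : X) : ∑ b, L.selProb d m x b = 1 := sum_igw _ _

variable [Nonempty A]

lemma ValidRates.gamma_pos {L : Learner X A} (hL : L.ValidRates) : 0 < L.gamma d m :=
  hL.gammaIdx_pos (L.index_mem d m)

lemma selProb_nonneg (x : X) (b : A) : 0 ≤ L.selProb d m x b :=
  (igw_pos L.le_argmax _ (L.gamma_nonneg d m) b).le

lemma selProb_le_one (x : X) (b : A) : L.selProb d m x b ≤ 1 :=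
  igw_le_one L.le_argmax _ (L.gamma_nonneg d m) b

lemma sum_selProb_mul_mem_Icc {u : A → ℝ} (hu : ∀ b, u b ∈ Set.Icc (0 : ℝ) 1) (x : X) :
    ∑ b, L.selProb d m x b * u b ∈ Set.Icc (0 : ℝ) 1 := by
  refine ⟨Finset.sum_nonneg fun b _ => mul_nonneg (L.selProb_nonneg d m x b) (hu b).1, ?_⟩
  rw [← L.sum_selProb d m x]
  exact Finset.sum_le_sum fun b _ => mul_le_of_le_one_right (L.selProb_nonneg d m x b) (hu b).2

end Basic

section Measurability

variable (m : ℕ)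

lemma measurable_epochData : Measurable fun d : ℕ → X × A × ℝ => L.epochData d m :=
  measurable_pi_lambda _ fun _ => measurable_pi_apply _

lemma measurable_model :
    Measurable fun q : (ℕ → X × A × ℝ) × X => L.model q.1 m q.2 := by
  obtain _ | _ | m := m
  · exact measurable_const
  · exact measurable_const
  · exact (L.est_measurable _).comp
      (((L.measurable_epochData (m + 1)).comp measurable_fst).prodMk measurable_snd)

lemma measurableSet_mem_indexSet (i : ℕ) :
    MeasurableSet {d : ℕ → X × A × ℝ | i ∈ L.indexSet d m} := by
  induction m with
  | zero => exact MeasurableSet.const _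
  | succ m ih =>
    cases m with
    | zero => exact MeasurableSet.const _
    | succ m =>
      simp only [indexSet, Finset.mem_filter]
      refine ih.inter ?_
      exact ((L.mt_measurable i _ _).comp (L.measurable_epochData (m + 1)))
        (measurableSet_singleton false)

/-- There are only countably many finite sets of indices, so measurability reduces to the events
that a given index belongs to the set. -/
lemma measurable_index : Measurable fun d : ℕ → X × A × ℝ => L.index d m := by
  let _ : MeasurableSpace (Finset ℕ) := ⊤
  have h : Measurable fun d : ℕ → X × A × ℝ => L.indexSet d m := by
    refine measurable_to_countable' fun s => ?_
    have : (fun d : ℕ → X × A × ℝ => L.indexSet d m) ⁻¹' {s} =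
        ⋂ i : ℕ, {d | i ∈ L.indexSet d m ↔ i ∈ s} := by
      ext d
      simp [Finset.ext_iff]
    rw [this]
    refine MeasurableSet.iInter fun i => ?_
    by_cases hi : i ∈ s
    · simpa [hi] using L.measurableSet_mem_indexSet m i
    · simp only [hi, iff_false]
      exact (L.measurableSet_mem_indexSet m i).compl
  classical
  exact (measurable_from_top (f := fun s : Finset ℕ =>
    if h : s.Nonempty then s.min' h else L.M)).comp h

variable [Fintype A]

lemma measurable_gamma : Measurable fun d : ℕ → X × A × ℝ => L.gamma d m :=
  (measurable_from_top (f := L.gammaIdx m)).comp (L.measurable_index m)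

variable [MeasurableSingletonClass A]

lemma measurable_selProb (b : A) :
    Measurable fun q : (ℕ → X × A × ℝ) × X => L.selProb q.1 m q.2 b :=
  (measurable_igw L.argmax_measurable b).comp
    ((L.measurable_model m).prodMk ((L.measurable_gamma m).comp measurable_fst))

end Measurability

end Learner

/-! ### The true gaps. -/

section Gap

variable {X A : Type*} [MeasurableSpace X] [MeasurableSpace A]
  (E : Environment X A) (L : Learner X A)

instance Environment.ctxLaw_isProb : IsProbabilityMeasure E.ctxLaw :=
  have := E.isProb
  Measure.isProbabilityMeasure_map measurable_fst.aemeasurable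

lemma Run.gap_mem_Icc (x : X) (b : A) : Run.gap E L x b ∈ Set.Icc (0 : ℝ) 1 := by
  refine ⟨gap_nonneg L.le_argmax _ b, ?_⟩
  have h1 := (E.fstar_mem x (L.argmax (E.fstar x))).2
  have h2 := (E.fstar_mem x b).1
  unfold Run.gap; linarith

variable [Fintype A] [MeasurableSingletonClass A]

lemma measurable_apply_argmax {argmax : (A → ℝ) → A} (hm : Measurable argmax) :
    Measurable fun v : A → ℝ => v (argmax v) := by
  have h : Measurable fun q : A × (A → ℝ) => q.2 q.1 :=
    measurable_from_prod_countable_right fun c => measurable_pi_apply c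
  exact h.comp (hm.prodMk measurable_id)

lemma Run.measurable_gap (b : A) : Measurable fun x => Run.gap E L x b :=
  ((measurable_apply_argmax L.argmax_measurable).comp E.fstar_measurable).sub
    ((measurable_pi_apply b).comp E.fstar_measurable)

end Gap

end ModIGW

noncomputable section

namespace ModIGW

/-! ### The pointwise discrepancy recursion and its integral over the contexts. -/

namespace Learner

variable {X A : Type*} [MeasurableSpace X] [MeasurableSpace A] [Fintype A]
  (L : Learner X A) (E : Environment X A) (d : ℕ → X × A × ℝ)

/-- The squared error at the context `x` of the model fitted after epoch `m`, averaged over the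
arms selected in epoch `m`. -/
def predErr (m : ℕ) (x : X) : ℝ :=
  ∑ b, L.selProb d m x b * (L.model d (m + 1) x b - E.fstar x b) ^ 2

/-- The expected regret of a round of epoch `m`. -/
def epochRegret (m : ℕ) : ℝ :=
  ∫ x, ∑ b, L.selProb d m x b * Run.gap E L x b ∂E.ctxLaw

/-- The summand of `rateSum` for the rounds of epoch `m + 1`. -/
def rateTerm (i j m : ℕ) : ℝ :=
  L.gammaIdx m j / L.gammaIdx m i *
    √(Fintype.card A * L.ξ i (epochLen L.τ₁ m) (L.conf (m + 1)))

/-- An upper bound for the additive discrepancy between true and estimated gaps at the context `x`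
in epoch `m₀ + k`, started from the trivial bound in epoch `m₀`. -/
def envelope (i m₀ : ℕ) : ℕ → X → ℝ
  | 0 => fun _ => 1
  | k + 1 => fun x => envelope i m₀ k x / 4 +
      (Fintype.card A / (5 * (L.gamma d (m₀ + k) + L.gammaIdx (m₀ + k + 1) i)) +
        20 * (L.gamma d (m₀ + k) + L.gammaIdx (m₀ + k + 1) i) * L.predErr E d (m₀ + k) x)

variable {L E d}

lemma envelope_succ (i m₀ k : ℕ) (x : X) : L.envelope E d i m₀ (k + 1) x =
    L.envelope E d i m₀ k x / 4 +
      (Fintype.card A / (5 * (L.gamma d (m₀ + k) + L.gammaIdx (m₀ + k + 1) i)) +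
        20 * (L.gamma d (m₀ + k) + L.gammaIdx (m₀ + k + 1) i) * L.predErr E d (m₀ + k) x) := rfl

section

variable [Nonempty A]

lemma predErr_mem_Icc (m : ℕ) (x : X) : L.predErr E d m x ∈ Set.Icc (0 : ℝ) 1 := by
  refine L.sum_selProb_mul_mem_Icc d m (fun b => ⟨sq_nonneg _, ?_⟩) x
  have h1 := L.model_mem_Icc d (m + 1) x b
  have h2 := E.fstar_mem x b
  exact (sq_le_one_iff_abs_le_one _).mpr
    (abs_le.mpr ⟨by linarith [h1.1, h2.2], by linarith [h1.2, h2.1]⟩)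

lemma envelope_nonneg (i m₀ k : ℕ) (x : X) : 0 ≤ L.envelope E d i m₀ k x := by
  induction k with
  | zero => exact zero_le_one
  | succ k ih =>
    rw [envelope_succ]
    have h1 := L.gamma_nonneg d (m₀ + k)
    have h2 := L.gammaIdx_nonneg (m₀ + k + 1) i
    have h3 := (predErr_mem_Icc (L := L) (E := E) (d := d) (m₀ + k) x).1
    positivity

lemma gap_comparison (hL : L.ValidRates) {i : ℕ} (hi : i ∈ Finset.Icc 1 L.M) (m₀ k : ℕ) (x : X)
    (b : A) :
    let v := L.model d (m₀ + k) x
    v (L.argmax v) - v b ≤ 2 * Run.gap E L x b + L.envelope E d i m₀ k x ∧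
      Run.gap E L x b ≤ 2 * (v (L.argmax v) - v b) + L.envelope E d i m₀ k x := by
  induction k generalizing b with
  | zero =>
    -- All gaps lie in `[0, 1]`, so discrepancy 1 is valid in any starting epoch.
    simp only [envelope, add_zero]
    have h1 := Run.gap_mem_Icc E L x b
    have h2 := gap_nonneg L.le_argmax (L.model d m₀ x) b
    have h3 := L.model_mem_Icc d m₀ x b
    have h4 := L.model_mem_Icc d m₀ x (L.argmax (L.model d m₀ x))
    constructor
    · linarith [h1.1, h3.1, h4.2]
    · linarith [h1.2]
  | succ k ih =>
    exact gap_comparison_step L.le_argmax (E.fstar x) (L.model d (m₀ + k) x)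
      (L.model d (m₀ + k + 1) x) (hL.gamma_pos d (m₀ + k)) (hL.gammaIdx_pos hi)
      (envelope_nonneg i m₀ k x) rfl (envelope_succ i m₀ k x) ih b

variable [MeasurableSingletonClass A]

omit [Nonempty A] in
variable (L E) in
lemma measurable_predErr_uncurry (m : ℕ) :
    Measurable fun q : (ℕ → X × A × ℝ) × X => L.predErr E q.1 m q.2 := by
  refine Finset.measurable_sum _ fun b _ => (L.measurable_selProb m b).mul ?_
  exact (((measurable_pi_apply b).comp (L.measurable_model (m + 1))).sub
    (((measurable_pi_apply b).comp E.fstar_measurable).comp measurable_snd)).pow_const 2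

omit [Nonempty A] in
lemma measurable_predErr (m : ℕ) : Measurable (L.predErr E d m) :=
  (L.measurable_predErr_uncurry E m).comp (measurable_const.prodMk measurable_id)

lemma integrable_predErr (m : ℕ) : Integrable (L.predErr E d m) E.ctxLaw := by
  refine Integrable.of_mem_Icc 0 1 (measurable_predErr m).aemeasurable (ae_of_all _ ?_)
  exact predErr_mem_Icc m

lemma integrable_envelope (i m₀ k : ℕ) : Integrable (L.envelope E d i m₀ k) E.ctxLaw := by
  induction k with
  | zero => exact integrable_const _
  | succ k ih =>
    exact (ih.div_const 4).add ((integrable_const _).add ((integrable_predErr _).const_mul _))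

lemma integral_envelope_succ (i m₀ k : ℕ) :
    ∫ x, L.envelope E d i m₀ (k + 1) x ∂E.ctxLaw =
    (∫ x, L.envelope E d i m₀ k x ∂E.ctxLaw) / 4 +
      (Fintype.card A / (5 * (L.gamma d (m₀ + k) + L.gammaIdx (m₀ + k + 1) i)) +
        20 * (L.gamma d (m₀ + k) + L.gammaIdx (m₀ + k + 1) i) *
          ∫ x, L.predErr E d (m₀ + k) x ∂E.ctxLaw) := by
  simp only [envelope_succ]
  have h : Integrable (fun x => (Fintype.card A : ℝ) /
      (5 * (L.gamma d (m₀ + k) + L.gammaIdx (m₀ + k + 1) i)) +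
        20 * (L.gamma d (m₀ + k) + L.gammaIdx (m₀ + k + 1) i) * L.predErr E d (m₀ + k) x)
      E.ctxLaw := (integrable_const _).add ((integrable_predErr _).const_mul _)
  rw [integral_add ((integrable_envelope _ _ _).div_const 4) h,
    integral_add (integrable_const _) ((integrable_predErr _).const_mul _),
    integral_div, integral_const_mul, integral_const]
  simp

omit [Nonempty A] in
variable (L E) in
lemma measurable_regret_integrand (m : ℕ) : Measurable fun q : (ℕ → X × A × ℝ) × X =>
    ∑ b, L.selProb q.1 m q.2 b * Run.gap E L q.2 b :=
  Finset.measurable_sum _ fun b _ =>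
    (L.measurable_selProb m b).mul ((Run.measurable_gap E L b).comp measurable_snd)

omit [Nonempty A] in
variable (L E) in
lemma measurable_epochRegret (m : ℕ) : Measurable fun d => L.epochRegret E d m :=
  ((L.measurable_regret_integrand E m).stronglyMeasurable.integral_prod_right').measurable

lemma integrable_regret_integrand (m : ℕ) :
    Integrable (fun x => ∑ b, L.selProb d m x b * Run.gap E L x b) E.ctxLaw := by
  refine Integrable.of_mem_Icc 0 1 ((L.measurable_regret_integrand E m).comp
    (measurable_const.prodMk measurable_id)).aemeasurable (ae_of_all _ fun x => ?_)
  exact L.sum_selProb_mul_mem_Icc d m (Run.gap_mem_Icc E L x) x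

omit [MeasurableSingletonClass A] in
lemma epochRegret_nonneg (m : ℕ) : 0 ≤ L.epochRegret E d m :=
  integral_nonneg fun x => (L.sum_selProb_mul_mem_Icc d m (Run.gap_mem_Icc E L x) x).1

lemma epochRegret_le_one (m : ℕ) : L.epochRegret E d m ≤ 1 := by
  have := integral_mono (integrable_regret_integrand (L := L) (d := d) m)
    (integrable_const (μ := E.ctxLaw) (1 : ℝ))
    fun x => (L.sum_selProb_mul_mem_Icc d m (Run.gap_mem_Icc E L x) x).2
  simpa [epochRegret] using this

lemma epochRegret_le (hL : L.ValidRates) {i : ℕ} (hi : i ∈ Finset.Icc 1 L.M) (m₀ k : ℕ) :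
    L.epochRegret E d (m₀ + k) ≤ 2 * (Fintype.card A / L.gamma d (m₀ + k)) +
      ∫ x, L.envelope E d i m₀ k x ∂E.ctxLaw := by
  have := integral_mono (integrable_regret_integrand (L := L) (d := d) (m₀ + k))
    ((integrable_const (μ := E.ctxLaw) (2 * (Fintype.card A / L.gamma d (m₀ + k)))).add
      (integrable_envelope (L := L) (E := E) (d := d) i m₀ k))
    fun x => sum_igw_mul_true_gap_le L.le_argmax (E.fstar x) (L.model d (m₀ + k) x)
      (hL.gamma_pos d (m₀ + k)) fun b => (gap_comparison hL hi m₀ k x b).2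
  rw [integral_add' (integrable_const _) (integrable_envelope _ _ _)] at this
  simpa [epochRegret] using this

end

/-! ### Rate sums and the accumulated expected regret. -/

section Rates

variable [Nonempty A]

omit [Nonempty A] in
lemma rateTerm_nonneg (i j m : ℕ) : 0 ≤ L.rateTerm i j m :=
  mul_nonneg (div_nonneg (L.gammaIdx_nonneg _ _) (L.gammaIdx_nonneg _ _)) (Real.sqrt_nonneg _)

lemma one_le_gammaIdx_div (hL : L.ValidRates) {i j m : ℕ} (hj : 1 ≤ j) (hji : j ≤ i)
    (hi : i ≤ L.M) : 1 ≤ L.gammaIdx m j / L.gammaIdx m i := by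
  rw [one_le_div (hL.gammaIdx_pos (Finset.mem_Icc.mpr ⟨hj.trans hji, hi⟩))]
  exact hL.gammaIdx_antitone_class hj hji hi

lemma sqrt_le_rateTerm (hL : L.ValidRates) {i j m : ℕ} (hj : 1 ≤ j) (hji : j ≤ i)
    (hi : i ≤ L.M) :
    √(Fintype.card A * L.ξ i (epochLen L.τ₁ m) (L.conf (m + 1))) ≤ L.rateTerm i j m :=
  le_mul_of_one_le_left (Real.sqrt_nonneg _) (one_le_gammaIdx_div hL hj hji hi)

omit [Nonempty A] in
lemma rateSum_nonneg (i j t : ℕ) : 0 ≤ L.rateSum i j t :=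
  Finset.sum_nonneg fun _ _ =>
    mul_nonneg (div_nonneg (L.gammaIdx_nonneg _ _) (L.gammaIdx_nonneg _ _)) (Real.sqrt_nonneg _)

omit [Nonempty A] in
lemma rateSum_mono (i j : ℕ) {t t' : ℕ} (h : t ≤ t') : L.rateSum i j t ≤ L.rateSum i j t' :=
  Finset.sum_le_sum_of_subset_of_nonneg (Finset.Icc_subset_Icc le_rfl h) fun _ _ _ =>
    mul_nonneg (div_nonneg (L.gammaIdx_nonneg _ _) (L.gammaIdx_nonneg _ _)) (Real.sqrt_nonneg _)

omit [Fintype A] [Nonempty A] in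
/-- A sum over rounds of a quantity that depends on the epoch only. -/
lemma sum_epochOf_add (f : ℕ → ℝ) {a m l : ℕ} (ha : a ≤ tau L.τ₁ m + 1)
    (hl : l ≤ epochLen L.τ₁ (m + 1)) :
    ∑ s ∈ Finset.Icc a (tau L.τ₁ m + l), f (epochOf L.τ₁ s) =
      (∑ s ∈ Finset.Icc a (tau L.τ₁ m), f (epochOf L.τ₁ s)) + l * f (m + 1) := by
  induction l with
  | zero => simp
  | succ l ih =>
    have h1 := tau_add_epochLen L.τ₁ m
    rw [← add_assoc, Finset.sum_Icc_succ_top (by omega), ih (by omega),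
      epochOf_eq L.two_le_τ₁ (m := m) (by omega) (by omega)]
    push_cast; ring

omit [Nonempty A] in
lemma rateSum_add (i j : ℕ) {m l : ℕ} (hm : 1 ≤ m) (hl : l ≤ epochLen L.τ₁ (m + 1)) :
    L.rateSum i j (tau L.τ₁ m + l) = L.rateSum i j (tau L.τ₁ m) + l * L.rateTerm i j m := by
  have h : L.τ₁ ≤ tau L.τ₁ m := by simpa [tau_one] using tau_mono L.τ₁ hm
  exact sum_epochOf_add (fun m => L.gammaIdx (m - 1) j / L.gammaIdx (m - 1) i *
    √(Fintype.card A * L.ξ i (epochLen L.τ₁ (m - 1)) (L.conf m))) (by omega) hl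

/-- The confidence radius of the regret is dominated by the sum of the rates. -/
lemma sqrt_tau_mul_log_le (hL : L.ValidRates) {i j m t : ℕ} (hj : 1 ≤ j) (hji : j ≤ i)
    (hi : i ≤ L.M) (ht : tau L.τ₁ (m + 3) ≤ t) :
    √(2 * tau L.τ₁ (m + 4) * Real.log (1 / L.conf (m + 4))) ≤ 3 * L.rateSum i j t := by
  have hiM : i ∈ Finset.Icc 1 L.M := Finset.mem_Icc.mpr ⟨hj.trans hji, hi⟩
  have hc2 := L.conf_pos (m := m + 2) (by omega)
  have hc4 := L.conf_pos (m := m + 4) (by omega)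
  have hc2' := L.conf_lt (m := m + 2) (by omega)
  set l := Real.log (1 / L.conf (m + 2)) with hl
  -- `m + 4 ≤ 2 * (m + 2)` loses at most a factor 4 in the confidence, and `conf (m + 2) < 1 / 4`
  -- turns that loss into a square, hence a doubled logarithm.
  have hlog : Real.log (1 / L.conf (m + 4)) ≤ 2 * l := by
    rw [hl, ← Nat.cast_two, ← Real.log_pow]
    refine Real.log_le_log (by positivity) ?_
    have h1 : 1 / 4 * L.conf (m + 2) ≤ L.conf (m + 4) := by
      have hM : (0 : ℝ) < L.M := by exact_mod_cast L.one_le_M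
      have hδ := L.δ_pos
      simp only [conf]
      rw [div_mul_div_comm, div_le_div_iff₀ (by positivity) (by positivity)]
      push_cast
      have hm0 : (0 : ℝ) ≤ m := Nat.cast_nonneg _
      have : ((m : ℝ) + 4) ^ 2 ≤ 4 * ((m : ℝ) + 2) ^ 2 := by nlinarith
      have := mul_le_mul_of_nonneg_left this (mul_pos hδ hM).le
      nlinarith
    rw [one_div_pow, div_le_div_iff₀ hc4 (by positivity)]
    nlinarith
  set T : ℝ := (tau L.τ₁ (m + 1) : ℝ) with hT
  have hTpos : 0 < T := by
    have : 0 < tau L.τ₁ (m + 1) := by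
      have := le_tau L.two_le_τ₁ (m + 1); omega
    rw [hT]; exact_mod_cast this
  have hT4 : (tau L.τ₁ (m + 4) : ℝ) = 8 * T := by
    rw [hT, tau_succ_succ, tau_succ_succ, tau_succ_succ]; push_cast; ring
  have hlpos : 0 < l := Real.log_pos (by rw [lt_div_iff₀ hc2]; linarith)
  have hterm : √(l / T) ≤ L.rateTerm i j (m + 2) := by
    refine le_trans (Real.sqrt_le_sqrt ?_) (sqrt_le_rateTerm hL hj hji hi)
    have h1 := (hL.xiZero_le_rate hiM (m := m + 2) (by omega)).trans
      (hL.rate_le_xi hiM (m' := m + 3) (by omega) (by omega))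
    have h2 : xiZero (epochLen L.τ₁ (m + 2)) (L.conf (m + 2)) = l / T := by
      rw [xiZero, epochLen_succ_succ]
    rw [h2] at h1
    have hK : (1 : ℝ) ≤ Fintype.card A := by exact_mod_cast Fintype.card_pos
    exact h1.trans (le_mul_of_one_le_left (le_trans (by positivity) h1) hK)
  -- Epoch `m + 3` is complete by round `t` and contributes `2 * T` rounds, where `T` is the length
  -- of epoch `m + 2`.
  have hsum : 2 * T * √(l / T) ≤ L.rateSum i j t := by
    refine le_trans ?_ (rateSum_mono i j ht)
    rw [← tau_add_epochLen, rateSum_add i j (by omega) le_rfl, epochLen_succ_succ, tau_succ_succ]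
    have := rateSum_nonneg (L := L) i j (2 * tau L.τ₁ (m + 1))
    push_cast
    nlinarith
  refine le_trans ?_ (mul_le_mul_of_nonneg_left hsum (by norm_num))
  refine Real.sqrt_le_iff.mpr ⟨by positivity, ?_⟩
  rw [hT4, mul_pow, mul_pow, Real.sq_sqrt (by positivity)]
  -- The squared radius is at most `2 * 8T * 2l = 32 T l`, below `36 T l`.
  have : (3 : ℝ) ^ 2 * ((2 * T) ^ 2 * (l / T)) = 36 * (T * l) := by field_simp; ring
  rw [this]
  nlinarith [mul_pos hTpos hlpos]

end Rates

variable [Nonempty A] [MeasurableSingletonClass A]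

lemma integral_envelope_succ_le (hL : L.ValidRates) {i j m₀ k : ℕ} (hj : 1 ≤ j) (hji : j ≤ i)
    (hi : i ≤ L.M) (hm₀ : 4 ≤ m₀)
    (hest : ∫ x, L.predErr E d (m₀ + k) x ∂E.ctxLaw ≤ 2 * L.rate i (m₀ + k))
    (hup : L.gamma d (m₀ + k) ≤ 3 * L.gammaIdx (m₀ + k) j) :
    ∫ x, L.envelope E d i m₀ (k + 1) x ∂E.ctxLaw ≤
      (∫ x, L.envelope E d i m₀ k x ∂E.ctxLaw) / 4 + 61 * L.rateTerm i j (m₀ + k) := by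
  have hiM : i ∈ Finset.Icc 1 L.M := Finset.mem_Icc.mpr ⟨hj.trans hji, hi⟩
  rw [integral_envelope_succ]
  obtain ⟨m, hm⟩ : ∃ m, m₀ + k = m + 1 := ⟨m₀ + k - 1, by omega⟩
  have hmono := hL.gammaIdx_mono_epoch hiM (m := m₀ + k) (by omega)
  rw [hm] at hest hup hmono ⊢
  set γ := L.gamma d (m + 1)
  set g := L.gammaIdx (m + 1 + 1) i with hgdef
  set g' := L.gammaIdx (m + 1) i with hgdef'
  set h := L.gammaIdx (m + 1) j
  have hγ : 0 < γ := hL.gamma_pos d (m + 1)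
  have hg : 0 < g := hL.gammaIdx_pos hiM
  have hg' : 0 < g' := hL.gammaIdx_pos hiM
  have hq : 1 ≤ h / g' := one_le_gammaIdx_div hL hj hji hi
  have hKg := hL.card_div_gammaIdx_le hiM (m := m) (m' := m + 2) (by omega)
  have hsq := hL.gammaIdx_sq hiM (m := m)
  have hK : (0 : ℝ) < Fintype.card A := by exact_mod_cast Fintype.card_pos
  have hT : L.rateTerm i j (m + 1) =
      h / g' * √(Fintype.card A * L.ξ i (epochLen L.τ₁ (m + 1)) (L.conf (m + 2))) := rfl
  set S := √(Fintype.card A * L.ξ i (epochLen L.τ₁ (m + 1)) (L.conf (m + 2)))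
  have hS : 0 ≤ S := Real.sqrt_nonneg _
  set q := h / g' with hqdef
  have hγq : γ ≤ 3 * q * g := by
    calc γ ≤ 3 * h := hup
      _ = 3 * q * g' := by rw [hqdef]; field_simp
      _ ≤ _ := by gcongr
  have hrate : L.rate i (m + 1) = Fintype.card A / g / (8 * g) := by
    rw [← hsq]; change _ = 8 * L.rate i (m + 1) * g ^ 2 / g / (8 * g); field_simp
  have h1 : (Fintype.card A : ℝ) / (5 * (γ + g)) ≤ q * S := by
    calc (Fintype.card A : ℝ) / (5 * (γ + g)) ≤ Fintype.card A / (5 * g) := by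
          gcongr; linarith
      _ = Fintype.card A / g / 5 := by field_simp
      _ ≤ q * S := by nlinarith
  -- Here `γ + g ≤ 4 q g`, and `8 ξ g² = K` balances the two terms: `20 * 4 q g * 2 ξ = 20 q K / g ≤
  -- 60 q S`. With `h1` this makes 61.
  have h2 : 20 * (γ + g) * ∫ x, L.predErr E d (m + 1) x ∂E.ctxLaw ≤ 60 * (q * S) := by
    calc 20 * (γ + g) * ∫ x, L.predErr E d (m + 1) x ∂E.ctxLaw
        ≤ 20 * (4 * q * g) * (2 * L.rate i (m + 1)) := by
          have : 0 ≤ ∫ x, L.predErr E d (m + 1) x ∂E.ctxLaw :=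
            integral_nonneg fun x => (predErr_mem_Icc _ x).1
          gcongr
          nlinarith
      _ = 20 * (q * (Fintype.card A / g)) := by rw [hrate]; field_simp; ring
      _ ≤ 20 * (q * (3 * S)) := by gcongr
      _ = _ := by ring
  rw [hT]
  linarith

/-- The bound of the expected regret from an epoch `m₀` on in which the comparison between true
and estimated gaps starts with the trivial discrepancy `1`. -/
lemma sum_epochRegret_le (hL : L.ValidRates) {i j m₀ μ : ℕ} (hj : 1 ≤ j) (hji : j ≤ i)
    (hi : i ≤ L.M) (hm₀ : 4 ≤ m₀)
    (hest : ∀ m, m₀ ≤ m → m < μ → ∫ x, L.predErr E d m x ∂E.ctxLaw ≤ 2 * L.rate i m)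
    (hlow : ∀ m, m₀ ≤ m → m ≤ μ → L.gammaIdx m i ≤ L.gamma d m)
    (hup : ∀ m, m₀ ≤ m → m < μ → L.gamma d m ≤ 3 * L.gammaIdx m j)
    {k l : ℕ} (hk : m₀ + k < μ) (hl : l ≤ epochLen L.τ₁ (m₀ + k + 1)) :
    ∑ s ∈ Finset.Icc 1 (tau L.τ₁ (m₀ + k) + l), L.epochRegret E d (epochOf L.τ₁ s) +
      l * ∫ x, L.envelope E d i m₀ (k + 1) x ∂E.ctxLaw ≤
      2 * tau L.τ₁ m₀ + 130 * L.rateSum i j (tau L.τ₁ (m₀ + k) + l) := by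
  have hiM : i ∈ Finset.Icc 1 L.M := Finset.mem_Icc.mpr ⟨hj.trans hji, hi⟩
  have hlen : ∀ k, epochLen L.τ₁ (m₀ + k + 1) = 2 * epochLen L.τ₁ (m₀ + k) := by
    intro k
    obtain ⟨n, hn⟩ : ∃ n, m₀ + k = n + 3 := ⟨m₀ + k - 3, by omega⟩
    rw [hn, epochLen_succ_succ, epochLen_succ_succ, tau_succ_succ]
  -- The invariant reserves the next discrepancy for every round played. The new discrepancy is
  -- counted twice, in the regret and in the reserve, and is a quarter of the old one plus `61 *
  -- rateTerm`. As the number of rounds at most doubles, half the old discrepancy times `l` is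
  -- covered by the old reserve. The rate terms sum to `2 * 3 + 2 * 61 = 128 ≤ 130`.
  have step : ∀ k l, m₀ + k < μ → l ≤ epochLen L.τ₁ (m₀ + k + 1) →
      ∑ s ∈ Finset.Icc 1 (tau L.τ₁ (m₀ + k)), L.epochRegret E d (epochOf L.τ₁ s) +
        epochLen L.τ₁ (m₀ + k) * ∫ x, L.envelope E d i m₀ k x ∂E.ctxLaw ≤
        2 * tau L.τ₁ m₀ + 130 * L.rateSum i j (tau L.τ₁ (m₀ + k)) →
      ∑ s ∈ Finset.Icc 1 (tau L.τ₁ (m₀ + k) + l), L.epochRegret E d (epochOf L.τ₁ s) +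
        l * ∫ x, L.envelope E d i m₀ (k + 1) x ∂E.ctxLaw ≤
        2 * tau L.τ₁ m₀ + 130 * L.rateSum i j (tau L.τ₁ (m₀ + k) + l) := by
    intro k l hk hl hprev
    rw [sum_epochOf_add (L.epochRegret E d) (by omega) hl, rateSum_add i j (by omega) hl]
    have h1 := integral_envelope_succ_le hL hj hji hi hm₀ (hest (m₀ + k) (by omega) hk)
      (hup (m₀ + k) (by omega) hk)
    have h2 := epochRegret_le (E := E) (d := d) hL hiM m₀ (k + 1)
    have h3 : (Fintype.card A : ℝ) / L.gamma d (m₀ + (k + 1)) ≤ 3 * L.rateTerm i j (m₀ + k) := by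
      obtain ⟨n, hn⟩ : ∃ n, m₀ + k = n + 1 := ⟨m₀ + k - 1, by omega⟩
      have h4 := hL.card_div_gammaIdx_le hiM (m := n) (m' := n + 2) (by omega)
      have h5 := sqrt_le_rateTerm hL (m := n + 1) hj hji hi
      have h6 := hlow (m₀ + (k + 1)) (by omega) (by omega)
      have h7 := hL.gammaIdx_pos hiM (m := m₀ + (k + 1))
      rw [← add_assoc] at h6 h7 ⊢
      rw [hn] at h6 h7 ⊢
      calc (Fintype.card A : ℝ) / L.gamma d (n + 1 + 1)
          ≤ Fintype.card A / L.gammaIdx (n + 1 + 1) i := by gcongr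
        _ ≤ _ := h4
        _ ≤ _ := by gcongr
    have ha : 0 ≤ ∫ x, L.envelope E d i m₀ k x ∂E.ctxLaw :=
      integral_nonneg fun x => envelope_nonneg i m₀ k x
    have hT := rateTerm_nonneg (L := L) i j (m₀ + k)
    have hl' : (l : ℝ) ≤ 2 * epochLen L.τ₁ (m₀ + k) := by
      rw [hlen] at hl; exact_mod_cast hl
    have hl0 : (0 : ℝ) ≤ l := Nat.cast_nonneg l
    rw [← add_assoc] at h2
    set a := ∫ x, L.envelope E d i m₀ k x ∂E.ctxLaw
    set a' := ∫ x, L.envelope E d i m₀ (k + 1) x ∂E.ctxLaw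
    have h8 : L.epochRegret E d (m₀ + k + 1) + a' ≤ 128 * L.rateTerm i j (m₀ + k) + a / 2 := by
      rw [← add_assoc] at h3
      linarith
    have h9 := mul_le_mul_of_nonneg_left h8 hl0
    have h10 := mul_le_mul_of_nonneg_right hl' ha
    have h11 := mul_nonneg hl0 hT
    linarith
  refine step k l hk hl ?_
  clear hl
  induction k with
  | zero =>
    -- One `τ_{m₀}` pays for the regret up to the start, the other for discrepancy 1 over one epoch
    -- length.
    simp only [add_zero, envelope]
    have h1 : ∑ s ∈ Finset.Icc 1 (tau L.τ₁ m₀), L.epochRegret E d (epochOf L.τ₁ s) ≤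
        tau L.τ₁ m₀ := by
      refine (Finset.sum_le_sum fun s _ => epochRegret_le_one (epochOf L.τ₁ s)).trans ?_
      simp
    have h2 : (epochLen L.τ₁ m₀ : ℝ) ≤ tau L.τ₁ m₀ := by exact_mod_cast Nat.sub_le _ _
    have h3 := rateSum_nonneg (L := L) i j (tau L.τ₁ m₀)
    simp only [integral_const, probReal_univ, smul_eq_mul, mul_one]
    linarith
  | succ k ih =>
    have := step k _ (by omega) le_rfl (ih (by omega))
    rwa [tau_add_epochLen] at this

end Learner

end ModIGW

end

/-! ### The regret bound for a single outcome of the good event. -/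

namespace ModIGW

lemma tauTop_coe (τ₁ n : ℕ) : tauTop τ₁ (n : ℕ∞) = (tau τ₁ n : ℝ≥0∞) := rfl

lemma lt_of_tau_lt_tauTop {τ₁ m : ℕ} {n : ℕ∞} (h : (tau τ₁ m : ℝ≥0∞) < tauTop τ₁ n) :
    (m : ℕ∞) < n := by
  induction n using ENat.recTopCoe with
  | top => exact ENat.natCast_lt_top m
  | coe n =>
    rw [tauTop_coe, Nat.cast_lt] at h
    exact_mod_cast (tau_mono τ₁).reflect_lt h

namespace Learner

variable {X A : Type*} [MeasurableSpace X] [MeasurableSpace A]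
  {L : Learner X A} {E : Environment X A} {F : ℕ → Set (X → A → ℝ)} {C₀ : ℝ}

/-- Before the safe epoch the estimation rate dominates the smallest misspecification error. -/
lemma misspec_le_rate_of_lt_safeEpoch (hL : L.ValidRates) {i m : ℕ}
    (hi : i ∈ Finset.Icc 1 L.M) (hm : 3 ≤ m) (h : (m : ℕ∞) < L.safeEpoch E F C₀ i) :
    ∃ k ∈ Finset.Icc 1 i, C₀ * E.maxMisspec (F k) ≤ L.rate i m := by
  unfold safeEpoch at h
  simp only [lt_iSup_iff] at h
  -- The supremum may be infinite; one qualifying epoch beyond `m` suffices, because the rate is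
  -- nonincreasing from epoch 3 on.
  obtain ⟨m', ⟨-, hm'⟩, hlt⟩ := h
  have hlt' : m < m' := by exact_mod_cast hlt
  have : Nonempty (Finset.Icc 1 i) :=
    ⟨⟨1, Finset.mem_Icc.mpr ⟨le_rfl, (Finset.mem_Icc.mp hi).1⟩⟩⟩
  obtain ⟨k, hk⟩ := exists_eq_ciInf_of_finite (f := fun k : Finset.Icc 1 i => E.maxMisspec (F k))
  exact ⟨k, k.2, hk ▸ hm'.trans (hL.rate_antitone_epoch hi hm hlt'.le)⟩

end Learner

namespace Run

variable {X A Ω : Type*} [MeasurableSpace X] [MeasurableSpace A] [Fintype A]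
  [MeasurableSpace Ω] {E : Environment X A} {L : Learner X A} {P : Measure Ω}
  (R : Run E L P)

lemma expRegret_eq (t : ℕ) (ω : Ω) : R.expRegret t ω =
    ∑ s ∈ Finset.Icc 1 t, L.epochRegret E (R.obs ω) (epochOf L.τ₁ s) := rfl

lemma regret_le (t : ℕ) (ω : Ω) : R.regret t ω ≤ t := by
  refine (Finset.sum_le_sum fun s _ => (gap_mem_Icc E L _ _).2).trans ?_
  simp

variable [Nonempty A] [MeasurableSingletonClass A]

lemma expRegret_le (t : ℕ) (ω : Ω) : R.expRegret t ω ≤ t := by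
  rw [expRegret_eq]
  refine (Finset.sum_le_sum fun s _ => Learner.epochRegret_le_one _).trans ?_
  simp

omit [MeasurableSingletonClass A] in
lemma regret_le_add (t : ℕ) (ω : Ω) : R.regret t ω ≤ L.τ₁ + R.expRegret t ω +
    ∑ s ∈ Finset.Icc (L.τ₁ + 1) t,
      (gap E L (R.x s ω) (R.a s ω) - L.epochRegret E (R.obs ω) (epochOf L.τ₁ s)) := by
  rcases le_or_gt t L.τ₁ with ht | ht
  · rw [Finset.Icc_eq_empty (by omega), Finset.sum_empty]
    have h1 := R.regret_le t ω
    have h2 : (t : ℝ) ≤ L.τ₁ := by exact_mod_cast ht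
    have h3 : 0 ≤ R.expRegret t ω := Finset.sum_nonneg fun s _ => Learner.epochRegret_nonneg _
    linarith
  · have hsplit : ∀ f : ℕ → ℝ, ∑ s ∈ Finset.Icc 1 t, f s =
        ∑ s ∈ Finset.Icc 1 L.τ₁, f s + ∑ s ∈ Finset.Icc (L.τ₁ + 1) t, f s := by
      intro f
      rw [← Finset.sum_union]
      · congr 1
        ext s
        simp only [Finset.mem_Icc, Finset.mem_union]
        omega
      · rw [Finset.disjoint_left]
        intro s
        simp only [Finset.mem_Icc]
        omega
    have h1 := R.regret_le L.τ₁ ω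
    have h3 : 0 ≤ R.expRegret L.τ₁ ω :=
      Finset.sum_nonneg fun s _ => Learner.epochRegret_nonneg _
    rw [Finset.sum_sub_distrib, regret, expRegret_eq, hsplit, hsplit]
    rw [regret] at h1
    rw [expRegret_eq] at h3
    linarith

/-- The regret bound on the event that the estimates are accurate, the tests are correct and the
regret is close to its conditional expectation. -/
theorem max_regret_le {F : ℕ → Set (X → A → ℝ)} {C₀ : ℝ} {β' : ℕ → ℝ} {β : ℕ → ℝ≥0∞}
    (hL : L.ValidRates) (hMT : R.MTGuarantee F C₀ β' β) {ω : Ω}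
    (hest : ∀ m, 3 ≤ m → ∀ k ∈ Finset.Icc 1 L.M, ∫ x, L.predErr E (R.obs ω) m x ∂E.ctxLaw ≤
      C₀ * E.maxMisspec (F k) + L.rate k m)
    (hacc : ∀ i ∈ Finset.Icc 1 L.M, ∀ m, 1 ≤ m →
      (tau L.τ₁ m : ℝ≥0∞) ≤ ENNReal.ofReal (β' i) * tauTop L.τ₁ (L.safeEpoch E F C₀ i) →
      L.mt i _ (L.epochData (R.obs ω) m) (L.conf m) = false)
    (hrej : ∀ i ∈ Finset.Icc 1 L.M, ∀ m, 1 ≤ m → β i < (tau L.τ₁ m : ℝ≥0∞) →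
      L.mt i _ (L.epochData (R.obs ω) m) (L.conf m) = true)
    (hdev : ∀ m, 3 ≤ m → ∀ t ≤ tau L.τ₁ m, ∑ s ∈ Finset.Icc (L.τ₁ + 1) t,
      (gap E L (R.x s ω) (R.a s ω) - L.epochRegret E (R.obs ω) (epochOf L.τ₁ s)) ≤
        √(2 * tau L.τ₁ m * Real.log (1 / L.conf m)))
    {i j : ℕ} (hi : i ∈ Finset.Icc 1 L.M) (hj : j ∈ Finset.Icc 1 L.M) (hβj : β (j - 1) ≠ ⊤)
    {t : ℕ} (ht : 1 ≤ t)
    (htβ : (t : ℝ≥0∞) ≤ ENNReal.ofReal (β' i) * tauTop L.τ₁ (L.safeEpoch E F C₀ i)) :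
    max (R.regret t ω) (R.expRegret t ω) ≤
      200 * (L.τ₁ + (β (j - 1)).toReal * L.logFactor (β (j - 1)).toReal i j +
        L.rateSum i j t) := by
  have hi' := Finset.mem_Icc.mp hi
  have hj' := Finset.mem_Icc.mp hj
  set b := (β (j - 1)).toReal with hb
  have hb0 : 0 ≤ b := ENNReal.toReal_nonneg
  have hΛ := L.maxLogRatio_nonneg i hb0
  have hRS := Learner.rateSum_nonneg (L := L) i j t
  have hτ0 : (0 : ℝ) ≤ L.τ₁ := Nat.cast_nonneg _
  have hβmono : ∀ k l, 1 ≤ k → k ≤ l → l ≤ L.M → β k ≤ β l := by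
    intro k l hk hkl hl
    induction l, hkl using Nat.le_induction with
    | base => exact le_rfl
    | succ n hn ih => exact (ih (by omega)).trans (hMT.beta_mono n (by omega) hl)
  have htriv : ∀ c : ℝ, (t : ℝ) ≤ c → max (R.regret t ω) (R.expRegret t ω) ≤ c := fun c hc =>
    max_le ((R.regret_le t ω).trans hc) ((R.expRegret_le t ω).trans hc)
  -- For `j > i` the round `t` does not exceed `β i ≤ β (j - 1)`, and the lower bound 1 built into
  -- `logFactor` lets the trivial bound `t` fit.
  rcases lt_or_ge i j with hij | hji
  · have h1 : β i ≤ β (j - 1) := hβmono i (j - 1) hi'.1 (by omega) (by omega)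
    have h2 : (t : ℝ≥0∞) ≤ β (j - 1) := by
      rcases hMT.beta_gt i hi with h | h
      · exact htβ.trans (h.le.trans h1)
      · exact absurd (top_le_iff.mp (h ▸ h1)) hβj
    have h3 : (t : ℝ) ≤ b := by
      have := ENNReal.toReal_mono hβj h2
      simpa using this
    refine htriv _ (h3.trans ?_)
    rw [Learner.logFactor, if_neg (by omega)]
    have := mul_le_mul_of_nonneg_left (le_max_left 1 (L.maxLogRatio b i)) hb0
    linarith
  rw [Learner.logFactor, if_pos hji]
  set d := R.obs ω with hd
  set μ := epochOf L.τ₁ t with hμ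
  have hμ1 : 1 ≤ μ := epochOf_pos L.two_le_τ₁ ht
  have htμ : t ≤ tau L.τ₁ μ := le_tau_epochOf L.two_le_τ₁ t
  have hμt : tau L.τ₁ (μ - 1) < t := tau_epochOf_lt L.two_le_τ₁ ht
  have hpast : ∀ m, m < μ → (tau L.τ₁ m : ℝ≥0∞) <
      ENNReal.ofReal (β' i) * tauTop L.τ₁ (L.safeEpoch E F C₀ i) := by
    intro m hm
    refine lt_of_lt_of_le ?_ htβ
    exact_mod_cast (tau_mono L.τ₁ (show m ≤ μ - 1 by omega)).trans_lt hμt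
  have hmem : ∀ m, m ≤ μ → i ∈ L.indexSet d m := by
    intro m
    induction m with
    | zero => exact fun _ => hi
    | succ m ih =>
      intro hm
      cases m with
      | zero => exact hi
      | succ m =>
        exact Finset.mem_filter.mpr ⟨ih (by omega),
          hacc i hi (m + 1) (by omega) (hpast (m + 1) (by omega)).le⟩
  have hlow : ∀ m, m ≤ μ → L.gammaIdx m i ≤ L.gamma d m := fun m hm =>
    hL.gammaIdx_antitone_class (Finset.mem_Icc.mp (L.index_mem d m)).1
      (L.index_le d m (hmem m hm)) hi'.2
  have hest' : ∀ m, 3 ≤ m → m < μ →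
      ∫ x, L.predErr E d m x ∂E.ctxLaw ≤ 2 * L.rate i m := by
    intro m hm hmμ
    have h1 : (m : ℕ∞) < L.safeEpoch E F C₀ i := by
      refine lt_of_tau_lt_tauTop (τ₁ := L.τ₁) ((hpast m hmμ).trans_le ?_)
      exact mul_le_of_le_one_left' (ENNReal.ofReal_le_one.mpr (hMT.beta'_mem i hi).2)
    obtain ⟨k, hk, hle⟩ := Learner.misspec_le_rate_of_lt_safeEpoch hL hi hm h1
    have hk' := Finset.mem_Icc.mp hk
    have h2 := hest m hm k (Finset.mem_Icc.mpr ⟨hk'.1, hk'.2.trans hi'.2⟩)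
    have h3 := hL.rate_mono_class hk'.1 hk'.2 hi'.2 (m := m) (by omega)
    linarith
  -- The test at the end of epoch `m - 1` already takes place after time `b`, so no class below `j`
  -- survives. Class `i` survives, so the convention for an empty index set is never used.
  have hrejected : ∀ m, epochAfter L.τ₁ b < m → m ≤ μ → L.gamma d m ≤ L.gammaIdx m j := by
    intro m hm hmμ
    refine hL.gammaIdx_antitone_class hj'.1 ?_ (Finset.mem_Icc.mp (L.index_mem d m)).2
    refine L.le_index d m ⟨i, hmem m hmμ⟩ fun k hk => ?_
    by_contra hkj
    have hkM := Finset.mem_Icc.mp (L.indexSet_subset d m hk)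
    have h1 := epochAfter_pos L.two_le_τ₁ hb0
    obtain ⟨n, rfl⟩ : ∃ n, m = n + 2 := ⟨m - 2, by omega⟩
    have h2 : b < tau L.τ₁ (n + 1) := (lt_tau_epochAfter L.two_le_τ₁ b).trans_le
      (by exact_mod_cast tau_mono L.τ₁ (by omega))
    have h3 : β k < (tau L.τ₁ (n + 1) : ℝ≥0∞) := by
      refine (hβmono k (j - 1) hkM.1 (by omega) (by omega)).trans_lt ?_
      rw [← ENNReal.toReal_lt_toReal hβj (ENNReal.natCast_ne_top _)]
      simpa using h2
    have h4 := hrej k (Finset.mem_Icc.mpr hkM) (n + 1) (by omega) h3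
    have h5 := (Finset.mem_filter.mp hk).2
    rw [h4] at h5
    exact Bool.noConfusion h5
  -- If the log ratio is below 1, all parameters between `γ_{m,i}` and `γ_{m,1}` agree up to `e < 3`
  -- and the recursion starts at once. Otherwise it starts after the rejections, and `b ≤ b * Λ`
  -- pays for the delay. Epoch 4 is the first from which `γ_{m,i}` is known to be nondecreasing.
  obtain ⟨m₀, hm₀, hτ, hup⟩ : ∃ m₀, 4 ≤ m₀ ∧
      (tau L.τ₁ m₀ : ℝ) ≤ 8 * L.τ₁ + 4 * (b * L.maxLogRatio b i) ∧
      ∀ m, m₀ ≤ m → m < μ → L.gamma d m ≤ 3 * L.gammaIdx m j := by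
    have h4 : tau L.τ₁ 4 = 8 * L.τ₁ := by simp [tau]
    have hjpos : ∀ m, 0 < L.gammaIdx m j := fun m => hL.gammaIdx_pos hj
    rcases lt_or_ge (L.maxLogRatio b i) 1 with hlt | hge
    · refine ⟨4, le_rfl, ?_, fun m hm hmμ => ?_⟩
      · rw [h4]; push_cast; linarith [mul_nonneg hb0 hΛ]
      · rcases le_or_gt m (epochAfter L.τ₁ b) with h | h
        · have h5 := (L.le_maxLogRatio (i := i) (by omega) h).trans_lt hlt
          have h6 := hL.gammaIdx_pos hi (m := m)
          have h7 : 0 < L.gammaIdx m 1 :=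
            hL.gammaIdx_pos (Finset.mem_Icc.mpr ⟨le_rfl, L.one_le_M⟩)
          rw [Real.log_lt_iff_lt_exp (by positivity), div_lt_iff₀ h6] at h5
          have h8 : L.gamma d m ≤ L.gammaIdx m 1 :=
            hL.gammaIdx_antitone_class le_rfl (Finset.mem_Icc.mp (L.index_mem d m)).1
              (Finset.mem_Icc.mp (L.index_mem d m)).2
          have h9 : L.gammaIdx m i ≤ L.gammaIdx m j :=
            hL.gammaIdx_antitone_class hj'.1 hji hi'.2
          have h10 := Real.exp_one_lt_d9
          nlinarith
        · have := hrejected m h hmμ.le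
          linarith [hjpos m]
    · refine ⟨max 4 (epochAfter L.τ₁ b + 1), le_max_left _ _, ?_, fun m hm hmμ => ?_⟩
      · rw [(tau_mono L.τ₁).map_max, h4]
        push_cast
        have h5 := tau_epochAfter_add_one_le L.two_le_τ₁ hb0
        have h6 := mul_le_mul_of_nonneg_left hge hb0
        exact max_le (by linarith) (by linarith)
      · have := hrejected m (by have := le_of_max_le_right hm; omega) hmμ.le
        linarith [hjpos m]
  have hbΛ := mul_nonneg hb0 hΛ
  rcases le_or_gt μ m₀ with hμm | hμm
  · refine htriv _ ?_
    have h1 : (t : ℝ) ≤ tau L.τ₁ m₀ := by exact_mod_cast htμ.trans (tau_mono L.τ₁ hμm)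
    linarith
  have hexp : R.expRegret t ω ≤ 2 * tau L.τ₁ m₀ + 130 * L.rateSum i j t := by
    obtain ⟨k, hk⟩ : ∃ k, μ = m₀ + k + 1 := ⟨μ - 1 - m₀, by omega⟩
    obtain ⟨l, hl⟩ : ∃ l, t = tau L.τ₁ (m₀ + k) + l := by
      rw [hk, Nat.add_sub_cancel] at hμt
      exact ⟨_, (Nat.add_sub_of_le hμt.le).symm⟩
    have h1 := Learner.sum_epochRegret_le (E := E) (d := d) hL hj'.1 hji hi'.2 hm₀
      (fun m h1 h2 => hest' m (by omega) h2) (fun m _ h2 => hlow m h2) hup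
      (k := k) (l := l) (by omega) (by
        have := tau_add_epochLen L.τ₁ (m₀ + k)
        rw [← hk] at this ⊢
        omega)
    rw [← hl] at h1
    have h2 : 0 ≤ ∫ x, L.envelope E d i m₀ (k + 1) x ∂E.ctxLaw :=
      integral_nonneg fun x => Learner.envelope_nonneg i m₀ (k + 1) x
    have h3 := mul_nonneg (Nat.cast_nonneg (α := ℝ) l) h2
    rw [expRegret_eq]
    linarith
  have hreg : R.regret t ω ≤ L.τ₁ + R.expRegret t ω + 3 * L.rateSum i j t := by
    have h1 := hdev μ (by omega) t htμ
    obtain ⟨n, hn⟩ : ∃ n, μ = n + 4 := ⟨μ - 4, by omega⟩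
    rw [hn] at h1 hμt
    have h2 := Learner.sqrt_tau_mul_log_le hL hj'.1 hji hi'.2 (m := n) (t := t) hμt.le
    have h3 := R.regret_le_add t ω
    linarith
  exact max_le (by linarith) (by linarith)

end Run

/-! ### A maximal inequality for bounded martingale differences. -/

/-- The Azuma-Hoeffding maximal inequality. The differences `Y s` are orthogonal to all bounded
nonnegative functions of the past. -/
lemma measure_exists_sum_gt_le {Ω : Type*} [m0 : MeasurableSpace Ω] {P : Measure Ω}
    [IsProbabilityMeasure P] (ℱ : ℕ → MeasurableSpace Ω) (hle : ∀ s, ℱ s ≤ m0)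
    (hmono : Monotone ℱ) (Y : ℕ → Ω → ℝ) (hY : ∀ s, Measurable[ℱ (s + 1)] (Y s))
    (hbd : ∀ s ω, |Y s ω| ≤ 1)
    (horth : ∀ s (W : Ω → ℝ), Measurable[ℱ s] W → (∀ ω, 0 ≤ W ω) → (∃ c, ∀ ω, W ω ≤ c) →
      ∫ ω, W ω * Y s ω ∂P = 0)
    {N : ℕ} (hN : 0 < N) {a : ℝ} (ha : 0 ≤ a) :
    P {ω | ∃ t ≤ N, a < ∑ s ∈ Finset.range t, Y s ω} ≤
      ENNReal.ofReal (Real.exp (-(a ^ 2 / (2 * N)))) := by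
  have hN' : (0 : ℝ) < N := by exact_mod_cast hN
  -- This `l` maximizes `l * a - N * l ^ 2 / 2`, with value `a ^ 2 / (2 * N)`.
  set l : ℝ := a / N with hl
  have hl0 : 0 ≤ l := by positivity
  let S : ℕ → Ω → ℝ := fun t ω => ∑ s ∈ Finset.range t, Y s ω
  have hS : ∀ t, Measurable[ℱ t] (S t) := fun t => by
    refine Finset.measurable_sum _ fun s hs => ?_
    exact (hY s).mono (hmono (Finset.mem_range.mp hs)) le_rfl
  let hit : ℕ → Set Ω := fun t => {ω | ∃ u ≤ t, a < S u ω}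
  have hhit : ∀ t, MeasurableSet[ℱ t] (hit t) := fun t => by
    have : hit t = ⋃ u ∈ Set.Iic t, {ω | a < S u ω} := by ext ω; simp [hit]
    rw [this]
    refine MeasurableSet.biUnion (Set.to_countable _) fun u hu => ?_
    exact hmono hu _ (hS u measurableSet_Ioi)
  -- The process `exp (l * S t - t * l ^ 2 / 2)`, stopped when the sum first exceeds `a`. In
  -- recursive form the increment carries a bounded nonnegative weight that is measurable in the
  -- past, as `horth` requires.
  let V : ℕ → Ω → ℝ := fun t => Nat.rec (fun _ => 1)
    (fun t v ω => v ω + (hit t)ᶜ.indicator v ω * (Real.exp (Y t ω * l - l ^ 2 / 2) - 1)) t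
  have hVs : ∀ t ω, V (t + 1) ω =
    V t ω + (hit t)ᶜ.indicator (V t) ω * (Real.exp (Y t ω * l - l ^ 2 / 2) - 1) :=
    fun t ω => rfl
  have hVpos : ∀ t ω, 0 < V t ω ∧ V t ω ≤ Real.exp (t * l) := by
    intro t
    induction t with
    | zero => intro ω; simp [V]
    | succ t ih =>
      intro ω
      obtain ⟨h1, h2⟩ := ih ω
      rw [hVs]
      by_cases h : ω ∈ hit t
      · rw [Set.indicator_of_notMem (by simpa using h), zero_mul, add_zero]
        refine ⟨h1, h2.trans (Real.exp_le_exp.mpr ?_)⟩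
        push_cast; linarith
      · rw [Set.indicator_of_mem (by simpa using h)]
        have h3 : V t ω + V t ω * (Real.exp (Y t ω * l - l ^ 2 / 2) - 1) =
          V t ω * Real.exp (Y t ω * l - l ^ 2 / 2) := by ring
        rw [h3]
        refine ⟨by positivity, ?_⟩
        calc V t ω * Real.exp (Y t ω * l - l ^ 2 / 2) ≤ Real.exp (t * l) * Real.exp l := by
              gcongr
              have := (abs_le.mp (hbd t ω)).2
              nlinarith [sq_nonneg l]
          _ = _ := by rw [← Real.exp_add]; push_cast; ring_nf
  have hVm : ∀ t, Measurable[ℱ t] (V t) := by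
    intro t
    induction t with
    | zero => exact measurable_const
    | succ t ih =>
      have h1 : Measurable[ℱ (t + 1)] (V t) := ih.mono (hmono (Nat.le_succ t)) le_rfl
      refine Measurable.add h1 (Measurable.mul ?_ ?_)
      · exact Measurable.indicator h1 (hmono (Nat.le_succ t) _ (hhit t)).compl
      · exact (Real.measurable_exp.comp
          (((hY t).mul measurable_const).sub measurable_const)).sub measurable_const
  have hVint : ∀ t, Integrable (V t) P := fun t =>
    Integrable.of_mem_Icc 0 (Real.exp (t * l)) ((hVm t).mono (hle t) le_rfl).aemeasurable
      (ae_of_all _ fun ω => ⟨(hVpos t ω).1.le, (hVpos t ω).2⟩)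
  have hVle : ∀ t, ∫ ω, V t ω ∂P ≤ 1 := by
    intro t
    induction t with
    | zero => simp [V]
    | succ t ih =>
      set W := (hit t)ᶜ.indicator (V t) with hW
      have hW0 : ∀ ω, 0 ≤ W ω := fun ω => Set.indicator_nonneg (fun ω _ => (hVpos t ω).1.le) ω
      have hWV : ∀ ω, W ω ≤ Real.exp (t * l) := fun ω =>
        (Set.indicator_le_self' (fun ω _ => (hVpos t ω).1.le) ω).trans (hVpos t ω).2
      have hWm : Measurable[ℱ t] W := Measurable.indicator (hVm t) (hhit t).compl
      set c := Real.exp (-(l ^ 2 / 2)) * Real.sinh l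
      have hWY : Integrable (fun ω => W ω * Y t ω) P := by
        refine Integrable.of_bound (C := Real.exp (t * l)) ((hWm.mono (hle t) le_rfl).mul
          ((hY t).mono (hle _) le_rfl)).aestronglyMeasurable (ae_of_all _ fun ω => ?_)
        rw [norm_mul, Real.norm_of_nonneg (hW0 ω), Real.norm_eq_abs]
        have := mul_le_mul (hWV ω) (hbd t ω) (abs_nonneg _) (Real.exp_pos _).le
        simpa using this
      -- Convexity gives `exp (y l) ≤ cosh l + y sinh l` on `[-1, 1]`, and `cosh l ≤ exp (l ^ 2 /
      -- 2)` cancels the compensator. What remains is linear in `Y t` and integrates to zero.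
      have hstep : ∀ ω, V (t + 1) ω ≤ V t ω + c * (W ω * Y t ω) := by
        intro ω
        rw [hVs]
        have h1 : Real.exp (Y t ω * l - l ^ 2 / 2) - 1 ≤ c * Y t ω := by
          have h2 := Real.exp_mul_le_cosh_add_mul_sinh (hbd t ω) l
          have h3 := Real.cosh_le_exp_half_sq l
          have h4 : Real.exp (Y t ω * l - l ^ 2 / 2) =
            Real.exp (-(l ^ 2 / 2)) * Real.exp (Y t ω * l) := by rw [← Real.exp_add]; ring_nf
          have h5 : Real.exp (-(l ^ 2 / 2)) * Real.exp (l ^ 2 / 2) = 1 := by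
            rw [← Real.exp_add]; simp
          have h6 := Real.exp_pos (-(l ^ 2 / 2))
          rw [h4]
          simp only [c]
          nlinarith [mul_le_mul_of_nonneg_left (h2.trans (add_le_add_left h3 _)) h6.le]
        have := mul_le_mul_of_nonneg_left h1 (hW0 ω)
        linarith
      have h1 := integral_mono (hVint (t + 1)) ((hVint t).add (hWY.const_mul c)) hstep
      rw [integral_add' (hVint t) (hWY.const_mul c), integral_const_mul,
        horth t W hWm hW0 ⟨_, hWV⟩] at h1
      linarith
  have hkey : ∀ t ≤ N, ∀ ω, (ω ∉ hit t → V t ω = Real.exp (l * S t ω - t * (l ^ 2 / 2))) ∧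
      (ω ∈ hit t → Real.exp (l * a - N * (l ^ 2 / 2)) ≤ V t ω) := by
    intro t
    induction t with
    | zero =>
      intro _ ω
      refine ⟨fun _ => by simp [V, S], fun h => ?_⟩
      obtain ⟨u, hu, hu'⟩ := h
      obtain rfl : u = 0 := by omega
      simp [S] at hu'
      linarith
    | succ t ih =>
      intro ht ω
      obtain ⟨h1, h2⟩ := ih (by omega) ω
      rw [hVs]
      by_cases h : ω ∈ hit t
      · rw [Set.indicator_of_notMem (by simpa using h), zero_mul, add_zero]
        refine ⟨fun h' => absurd ?_ h', fun _ => h2 h⟩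
        obtain ⟨u, hu, hu'⟩ := h
        exact ⟨u, by omega, hu'⟩
      · rw [Set.indicator_of_mem (by simpa using h)]
        have h3 : V t ω + V t ω * (Real.exp (Y t ω * l - l ^ 2 / 2) - 1) =
            Real.exp (l * S (t + 1) ω - ((t + 1 : ℕ) : ℝ) * (l ^ 2 / 2)) := by
          rw [h1 h, mul_sub, ← Real.exp_add, mul_one, add_sub_cancel]
          simp only [S, Finset.sum_range_succ]
          push_cast; ring_nf
        rw [h3]
        refine ⟨fun _ => rfl, fun h' => ?_⟩
        obtain ⟨u, hu, hu'⟩ := h'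
        obtain rfl : u = t + 1 := by
          by_contra hne
          exact h ⟨u, by omega, hu'⟩
        refine Real.exp_le_exp.mpr ?_
        have h4 : ((t + 1 : ℕ) : ℝ) ≤ N := by exact_mod_cast ht
        have h5 := mul_le_mul_of_nonneg_right h4 (by positivity : 0 ≤ l ^ 2 / 2)
        have h6 := mul_le_mul_of_nonneg_left hu'.le hl0
        linarith
  have hexp : l * a - N * (l ^ 2 / 2) = a ^ 2 / (2 * N) := by
    rw [hl]; field_simp; ring
  have hmark := mul_meas_ge_le_integral_of_nonneg (μ := P) (f := V N)
    (ae_of_all _ fun ω => (hVpos N ω).1.le) (hVint N) (Real.exp (a ^ 2 / (2 * N)))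
  have hsub : {ω | ∃ t ≤ N, a < ∑ s ∈ Finset.range t, Y s ω} ⊆
      {ω | Real.exp (a ^ 2 / (2 * N)) ≤ V N ω} := fun ω hω => hexp ▸ (hkey N le_rfl ω).2 hω
  refine (measure_mono hsub).trans ?_
  rw [← ofReal_measureReal]
  refine ENNReal.ofReal_le_ofReal ?_
  rw [Real.exp_neg, ← one_div, le_div_iff₀ (Real.exp_pos _), mul_comm]
  exact hmark.trans (hVle N)

end ModIGW

noncomputable section

namespace ModIGW

/-! ### Kernels with finitely many arms and the sampling law. -/

section Sampling

variable {X A : Type*} [MeasurableSpace X] [MeasurableSpace A] [Fintype A]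

/-- The kernel on a finite set with given weights. -/
def weightKernel (q : X → A → ℝ) (hq : ∀ b, Measurable fun x => q x b) : Kernel X A where
  toFun x := ∑ b, ENNReal.ofReal (q x b) • Measure.dirac b
  measurable' := by
    refine Measure.measurable_of_measurable_coe _ fun s _ => ?_
    simp only [Measure.finsetSum_apply, Measure.smul_apply, smul_eq_mul]
    exact Finset.measurable_sum _ fun b _ => (hq b).ennreal_ofReal.mul_const _

variable {q : X → A → ℝ} {hq : ∀ b, Measurable fun x => q x b}

lemma weightKernel_apply (x : X) :
    weightKernel q hq x = ∑ b, ENNReal.ofReal (q x b) • Measure.dirac b := rfl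

lemma isMarkovKernel_weightKernel (h0 : ∀ x b, 0 ≤ q x b) (h1 : ∀ x, ∑ b, q x b = 1) :
    IsMarkovKernel (weightKernel q hq) := by
  refine ⟨fun x => ⟨?_⟩⟩
  simp only [weightKernel_apply, Measure.finsetSum_apply, Measure.smul_apply, smul_eq_mul,
    measure_univ, mul_one]
  rw [← ENNReal.ofReal_sum_of_nonneg fun b _ => h0 x b, h1, ENNReal.ofReal_one]

variable [MeasurableSingletonClass A] (E : Environment X A)

lemma sqErr_weightKernel (h0 : ∀ x b, 0 ≤ q x b) (f : X → A → ℝ) :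
    E.sqErr (weightKernel q hq) f =
      ∫ x, ∑ b, q x b * (f x b - E.fstar x b) ^ 2 ∂E.ctxLaw := by
  unfold Environment.sqErr
  congr 1
  funext x
  rw [weightKernel_apply, integral_finsetSum_measure]
  · refine Finset.sum_congr rfl fun b _ => ?_
    rw [integral_smul_measure, integral_dirac, ENNReal.toReal_ofReal (h0 x b), smul_eq_mul]
  · intro b _
    exact (integrable_dirac (by simp)).smul_measure ENNReal.ofReal_ne_top

lemma measurable_observe :
    Measurable fun z : (X × (A → ℝ)) × A => ((z.1.1, z.2, z.1.2 z.2) : X × A × ℝ) := by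
  have h : Measurable fun z : (A → ℝ) × A => z.1 z.2 :=
    measurable_from_prod_countable_left fun b => measurable_pi_apply b
  exact (measurable_fst.comp measurable_fst).prodMk (measurable_snd.prodMk
    (h.comp ((measurable_snd.comp measurable_fst).prodMk measurable_snd)))

lemma isProbabilityMeasure_sampleLaw (p : Kernel X A) [IsMarkovKernel p] :
    IsProbabilityMeasure (E.sampleLaw p) :=
  have := E.isProb
  Measure.isProbabilityMeasure_map measurable_observe.aemeasurable

lemma lintegral_sampleLaw (h0 : ∀ x b, 0 ≤ q x b) (h1 : ∀ x, ∑ b, q x b = 1)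
    {f : X × A × ℝ → ℝ≥0∞} (hf : Measurable f) :
    ∫⁻ y, f y ∂E.sampleLaw (weightKernel q hq) =
      ∫⁻ z, ∑ b, ENNReal.ofReal (q z.1 b) * f (z.1, b, z.2 b) ∂E.law := by
  have := E.isProb
  have := isMarkovKernel_weightKernel (hq := hq) h0 h1
  unfold Environment.sampleLaw
  have hfm : Measurable fun z : (X × (A → ℝ)) × A => f (z.1.1, z.2, z.1.2 z.2) :=
    hf.comp measurable_observe
  rw [lintegral_map hf measurable_observe, Measure.lintegral_compProd hfm]
  congr 1
  funext z
  rw [Kernel.comap_apply, weightKernel_apply, lintegral_finsetSum_measure]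
  simp only [lintegral_smul_measure, smul_eq_mul, lintegral_dirac]

/-- Integration against a power of a measure, with the last coordinate split off. -/
lemma lintegral_pi_succ_last {Z : Type*} [MeasurableSpace Z] (ν : Measure Z)
    [IsProbabilityMeasure ν] {k : ℕ} {f : (Fin (k + 1) → Z) → ℝ≥0∞} (hf : Measurable f) :
    ∫⁻ S, f S ∂Measure.pi (fun _ => ν) =
      ∫⁻ S : Fin k → Z, ∫⁻ z, f (Fin.snoc (α := fun _ => Z) S z) ∂ν ∂Measure.pi (fun _ => ν) := by
  have h := (measurePreserving_piFinSuccAbove (fun _ : Fin (k + 1) => ν) (Fin.last k)).symm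
  have hfm : Measurable fun z =>
      f ((MeasurableEquiv.piFinSuccAbove (fun _ => Z) (Fin.last k)).symm z) :=
    hf.comp (MeasurableEquiv.measurable _)
  rw [← h.lintegral_comp hf, lintegral_prod_symm _ hfm.aemeasurable]
  congr 1
  funext S
  congr 1
  funext z
  congr 1
  simp [MeasurableEquiv.piFinSuccAbove, Fin.insertNthEquiv, Fin.insertNth_last']

end Sampling

/-! ### Integrating out one round of a run given its past. -/

namespace Run

variable {X A Ω : Type*} [MeasurableSpace X] [MeasurableSpace A] [Fintype A]
  [MeasurableSpace Ω] {E : Environment X A} {L : Learner X A} {P : Measure Ω}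
  (R : Run E L P)

/-- The information available before round `t`. -/
abbrev past (t : ℕ) : MeasurableSpace Ω :=
  ⨆ s ∈ Finset.Ico 1 t,
    MeasurableSpace.comap (fun ω => (R.x s ω, R.r s ω, R.a s ω)) inferInstance

/-- The information contained in the context and the rewards of round `t`. -/
abbrev current (t : ℕ) : MeasurableSpace Ω :=
  MeasurableSpace.comap (fun ω => (R.x t ω, R.r t ω)) inferInstance

lemma past_mono : Monotone R.past := fun _ _ h =>
  biSup_mono fun _ hs => Finset.Ico_subset_Ico le_rfl h hs

lemma past_le (t : ℕ) : R.past t ≤ ‹MeasurableSpace Ω› :=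
  iSup₂_le fun s _ => ((R.x_measurable s).prodMk
    ((R.r_measurable s).prodMk (R.a_measurable s))).comap_le

lemma measurable_past_triple {s t : ℕ} (hs : 1 ≤ s) (hst : s < t) :
    Measurable[R.past t] fun ω => (R.x s ω, R.r s ω, R.a s ω) := by
  rw [measurable_iff_comap_le]
  exact le_iSup₂ (f := fun s (_ : s ∈ Finset.Ico 1 t) =>
    MeasurableSpace.comap (fun ω => (R.x s ω, R.r s ω, R.a s ω)) inferInstance) s
    (Finset.mem_Ico.mpr ⟨hs, hst⟩)

section

variable [MeasurableSingletonClass A]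

lemma measurable_past_obs {s t : ℕ} (hs : 1 ≤ s) (hst : s < t) :
    Measurable[R.past t] fun ω => R.obs ω s := by
  have h : Measurable fun z : X × (A → ℝ) × A => ((z.1, z.2.2, z.2.1 z.2.2) : X × A × ℝ) :=
    measurable_observe.comp ((measurable_fst.prodMk (measurable_fst.comp measurable_snd)).prodMk
      (measurable_snd.comp measurable_snd))
  exact h.comp (R.measurable_past_triple hs hst)

lemma measurable_obs : Measurable R.obs := by
  refine measurable_pi_lambda _ fun s => ?_
  exact measurable_observe.comp
    (((R.x_measurable s).prodMk (R.r_measurable s)).prodMk (R.a_measurable s))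

/-- The stream of observations, frozen after round `T`. -/
def frozenObs (T : ℕ) (ω : Ω) (s : ℕ) : X × A × ℝ := R.obs ω (max 1 (min s T))

/-- Clamping the index to `1, …, T` keeps every coordinate in the past, to which round 0 does not
belong. -/
lemma measurable_frozenObs {T t : ℕ} (hT : 1 ≤ T) (hTt : T < t) :
    Measurable[R.past t] (R.frozenObs T) := by
  refine @measurable_pi_lambda Ω ℕ (fun _ => X × A × ℝ) (R.past t) _ _ fun s => ?_
  exact R.measurable_past_obs (by omega) (by omega)

end

lemma frozenObs_apply {T s : ℕ} (hs : 1 ≤ s) (hsT : s ≤ T) (ω : Ω) :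
    R.frozenObs T ω s = R.obs ω s := by
  unfold frozenObs; congr 1; omega

lemma selProb_frozenObs {T m : ℕ} (h : tau L.τ₁ (m - 1) ≤ T) (ω : Ω) :
    L.selProb (R.frozenObs T ω) m = L.selProb (R.obs ω) m :=
  L.selProb_congr fun _ hs hsT => R.frozenObs_apply hs (hsT.trans h) ω

variable [MeasurableSingletonClass A] [Nonempty A] [IsProbabilityMeasure P]
  {α : Type*} [MeasurableSpace α] {t : ℕ} {h : Ω → α} {q : α → X → A → ℝ}

/-- The law of the history, the context and the rewards on the event that a given arm is
selected. -/
lemma map_restrict_action (ht : 1 ≤ t) (hh : Measurable[R.past t] h)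
    (hq : ∀ b, Measurable fun z : α × X => q z.1 z.2 b)
    (hsel : ∀ ω, L.selProb (R.obs ω) (epochOf L.τ₁ t) = q (h ω)) (b : A) :
    (P.restrict (R.a t ⁻¹' {b})).map (fun ω => (h ω, R.x t ω, R.r t ω)) =
      (P.map (fun ω => (h ω, R.x t ω, R.r t ω))).withDensity
        fun z => ENNReal.ofReal (q z.1 z.2.1 b) := by
  have hz : Measurable fun ω => (R.x t ω, R.r t ω) :=
    (R.x_measurable t).prodMk (R.r_measurable t)
  have hle : R.past t ⊔ R.current t ≤ ‹MeasurableSpace Ω› := sup_le (R.past_le t) hz.comap_le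
  have hH : Measurable[R.past t ⊔ R.current t] fun ω => (h ω, R.x t ω, R.r t ω) :=
    Measurable.prodMk (hh.mono le_sup_left le_rfl)
      (Measurable.mono (measurable_iff_comap_le.mpr le_rfl) le_sup_right le_rfl)
  have hH' : Measurable fun ω => (h ω, R.x t ω, R.r t ω) := hH.mono hle le_rfl
  have hab : MeasurableSet (R.a t ⁻¹' {b}) := R.a_measurable t (measurableSet_singleton b)
  have hqm : Measurable fun z : α × X × (A → ℝ) => q z.1 z.2.1 b :=
    (hq b).comp (measurable_fst.prodMk (measurable_fst.comp measurable_snd))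
  have hae := R.action_law t ht b
  change P[_ | R.past t ⊔ R.current t] =ᵐ[P] _ at hae
  ext s hs
  have hs' : MeasurableSet[R.past t ⊔ R.current t]
      ((fun ω => (h ω, R.x t ω, R.r t ω)) ⁻¹' s) := hH hs
  set s' := (fun ω => (h ω, R.x t ω, R.r t ω)) ⁻¹' s
  rw [Measure.map_apply hH' hs, withDensity_apply _ hs,
    setLIntegral_map hs hqm.ennreal_ofReal hH', Measure.restrict_apply (hle _ hs')]
  have hint : Integrable ((R.a t ⁻¹' {b}).indicator fun _ => (1 : ℝ)) P :=
    (integrable_const _).indicator hab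
  -- Tested on an event of the past and the current pair, the conditional law of the arm becomes a
  -- density.
  have h1 := setIntegral_condExp hle hint hs'
  rw [setIntegral_indicator hab, setIntegral_const, smul_eq_mul, mul_one,
    setIntegral_congr_ae (g := fun ω => q (h ω) (R.x t ω) b) (hle _ hs')
      (by filter_upwards [hae] with ω hω _; rw [hω, ← hsel ω]; rfl)] at h1
  have hqI : ∀ ω, q (h ω) (R.x t ω) b ∈ Set.Icc (0 : ℝ) 1 := fun ω => by
    rw [← hsel ω]
    exact ⟨L.selProb_nonneg _ _ _ _, L.selProb_le_one _ _ _ _⟩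
  rw [← ofReal_measureReal, ← h1, ofReal_integral_eq_lintegral_ofReal]
  · exact Integrable.of_mem_Icc 0 1 (hqm.comp hH').aemeasurable (ae_of_all _ hqI)
  · exact ae_of_all _ fun ω => (hqI ω).1

/-- Integration over a round given the past. -/
lemma lintegral_round (ht : 1 ≤ t) (hh : Measurable[R.past t] h)
    (hq : ∀ b, Measurable fun z : α × X => q z.1 z.2 b)
    (hsel : ∀ ω, L.selProb (R.obs ω) (epochOf L.τ₁ t) = q (h ω))
    {f : α → X × A × ℝ → ℝ≥0∞} (hf : Measurable fun z : α × X × A × ℝ => f z.1 z.2) :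
    ∫⁻ ω, f (h ω) (R.obs ω t) ∂P =
      ∫⁻ ω, ∫⁻ z, ∑ b, ENNReal.ofReal (q (h ω) z.1 b) * f (h ω) (z.1, b, z.2 b) ∂E.law ∂P := by
  classical
  have := E.isProb
  have hz : Measurable fun ω => (R.x t ω, R.r t ω) :=
    (R.x_measurable t).prodMk (R.r_measurable t)
  have hh' : Measurable h := hh.mono (R.past_le t) le_rfl
  have hH' : Measurable fun ω => (h ω, R.x t ω, R.r t ω) := hh'.prodMk hz
  have hqm : ∀ b, Measurable fun z : α × X × (A → ℝ) => q z.1 z.2.1 b := fun b =>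
    (hq b).comp (measurable_fst.prodMk (measurable_fst.comp measurable_snd))
  have hfm : ∀ b, Measurable fun z : α × X × (A → ℝ) => f z.1 (z.2.1, b, z.2.2 b) := fun b =>
    hf.comp (measurable_fst.prodMk ((measurable_fst.comp measurable_snd).prodMk
      (measurable_const.prodMk
        ((measurable_pi_apply b).comp (measurable_snd.comp measurable_snd)))))
  have hab : ∀ b, MeasurableSet (R.a t ⁻¹' {b}) := fun b =>
    R.a_measurable t (measurableSet_singleton b)
  have hsplit : ∀ ω, f (h ω) (R.obs ω t) = ∑ b, (R.a t ⁻¹' {b}).indicator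
      (fun ω => f (h ω) (R.x t ω, b, R.r t ω b)) ω := by
    intro ω
    rw [Finset.sum_eq_single (R.a t ω)]
    · rw [Set.indicator_of_mem (by simp)]; rfl
    · intro b _ hb
      exact Set.indicator_of_notMem (by simpa using hb.symm) _
    · simp
  -- Independence of the current pair from the past makes the joint law a product, so Fubini applies
  -- once the arm has been replaced by its density.
  have hprod : P.map (fun ω => (h ω, R.x t ω, R.r t ω)) = (P.map h).prod E.law := by
    rw [← R.law_eq t ht]
    refine (indepFun_iff_map_prod_eq_prod_map_map hh'.aemeasurable hz.aemeasurable).mp ?_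
    exact indep_of_indep_of_le_left (R.indep_past t ht) (measurable_iff_comap_le.mp hh)
  have hqf : ∀ b, Measurable fun z : α × X × (A → ℝ) =>
      ENNReal.ofReal (q z.1 z.2.1 b) * f z.1 (z.2.1, b, z.2.2 b) := fun b =>
    (hqm b).ennreal_ofReal.mul (hfm b)
  have hsm := Finset.measurable_fun_sum Finset.univ fun b _ => hqf b
  simp_rw [hsplit]
  have hfm' : ∀ b, Measurable ((R.a t ⁻¹' {b}).indicator
      fun ω => f (h ω) (R.x t ω, b, R.r t ω b)) := fun b =>
    Measurable.indicator ((hfm b).comp hH') (hab b)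
  rw [lintegral_finsetSum _ fun b _ => hfm' b]
  calc ∑ b, ∫⁻ ω, (R.a t ⁻¹' {b}).indicator (fun ω => f (h ω) (R.x t ω, b, R.r t ω b)) ω ∂P
      = ∑ b, ∫⁻ z, ENNReal.ofReal (q z.1 z.2.1 b) * f z.1 (z.2.1, b, z.2.2 b)
          ∂(P.map fun ω => (h ω, R.x t ω, R.r t ω)) := by
        refine Finset.sum_congr rfl fun b _ => ?_
        rw [lintegral_indicator (hab b),
          ← lintegral_map (f := fun z : α × X × (A → ℝ) => f z.1 (z.2.1, b, z.2.2 b)) (hfm b) hH',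
          R.map_restrict_action ht hh hq hsel b,
          lintegral_withDensity_eq_lintegral_mul _ (hqm b).ennreal_ofReal (hfm b)]
        rfl
    _ = ∫⁻ z, ∑ b, ENNReal.ofReal (q z.1 z.2.1 b) * f z.1 (z.2.1, b, z.2.2 b)
          ∂(P.map h).prod E.law := by
        rw [hprod, lintegral_finsetSum _ fun b _ => hqf b]
    _ = _ := by
        rw [lintegral_prod _ hsm.aemeasurable, lintegral_map hsm.lintegral_prod_right' hh']

end Run

end ModIGW

end

noncomputable section

namespace ModIGW

/-! ### The conditional i.i.d. structure of an epoch and the estimation oracle. -/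

namespace Environment

variable {X A : Type*} [MeasurableSpace X] [MeasurableSpace A] (E : Environment X A)

lemma sqErr_le_one (p : Kernel X A) [IsMarkovKernel p] {f : X → A → ℝ}
    (hf : ∀ x a, f x a ∈ Set.Icc (0 : ℝ) 1) : E.sqErr p f ≤ 1 := by
  have hsq : ∀ x a, ‖(f x a - E.fstar x a) ^ 2‖ ≤ 1 := fun x a => by
    have h1 := hf x a
    have h2 := E.fstar_mem x a
    rw [Real.norm_of_nonneg (sq_nonneg _)]
    exact (sq_le_one_iff_abs_le_one _).mpr
      (abs_le.mpr ⟨by linarith [h1.1, h2.2], by linarith [h1.2, h2.1]⟩)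
  have h := norm_integral_le_of_norm_le_const (μ := E.ctxLaw) (C := 1)
    (f := fun x => ∫ a, (f x a - E.fstar x a) ^ 2 ∂(p x)) (ae_of_all _ fun x => by
      simpa using norm_integral_le_of_norm_le_const (μ := p x) (ae_of_all _ (hsq x)))
  exact ((le_abs_self _).trans h).trans (by simp)

lemma sqErr_nonneg (p : Kernel X A) (f : X → A → ℝ) : 0 ≤ E.sqErr p f :=
  integral_nonneg fun _ => integral_nonneg fun _ => sq_nonneg _

/-- The supremum of an unbounded real family would be the default 0; models with values in `[0, 1]`
keep the errors in `[0, 1]`. -/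
lemma misspec_le_maxMisspec {F : Set (X → A → ℝ)} (hF : IsModelClass F) (p : Kernel X A)
    [hp : IsMarkovKernel p] : E.misspec F p ≤ E.maxMisspec F := by
  refine le_ciSup (f := fun p : {p : Kernel X A // IsMarkovKernel p} => E.misspec F p.1)
    ⟨1, ?_⟩ ⟨p, hp⟩
  rintro _ ⟨⟨p, hp⟩, rfl⟩
  obtain ⟨f, hf⟩ := hF.nonempty
  exact (ciInf_le (f := fun f : F => E.sqErr p f)
    ⟨0, by rintro _ ⟨f, rfl⟩; exact E.sqErr_nonneg p f⟩ ⟨f, hf⟩).trans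
    (E.sqErr_le_one p (hF.mem_Icc f hf))

end Environment

namespace Run

variable {X A Ω : Type*} [MeasurableSpace X] [MeasurableSpace A] [Fintype A]
  [MeasurableSpace Ω] {E : Environment X A} {L : Learner X A} {P : Measure Ω}
  (R : Run E L P) [MeasurableSingletonClass A]

variable (L) in
/-- The selection kernel of epoch `m`. -/
abbrev _root_.ModIGW.Learner.selKernel (d : ℕ → X × A × ℝ) (m : ℕ) : Kernel X A :=
  weightKernel (L.selProb d m) fun b =>
    (L.measurable_selProb m b).comp (measurable_const.prodMk measurable_id)

instance [Nonempty A] (d : ℕ → X × A × ℝ) (m : ℕ) : IsMarkovKernel (L.selKernel d m) :=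
  isMarkovKernel_weightKernel (L.selProb_nonneg d m) (L.sum_selProb d m)

/-- The first `k` observations after round `T`. -/
def block (T k : ℕ) (ω : Ω) : Fin k → X × A × ℝ := fun l => R.obs ω (T + 1 + l)

variable [Nonempty A] [IsProbabilityMeasure P]

/-- Given the observations of the previous epochs, the observations of an epoch are independent
samples from the law that is defined by the selection kernel of that epoch. -/
lemma lintegral_block {n k : ℕ} (hk : k ≤ epochLen L.τ₁ (n + 2))
    {f : (ℕ → X × A × ℝ) → (Fin k → X × A × ℝ) → ℝ≥0∞}
    (hf : Measurable fun z : (ℕ → X × A × ℝ) × (Fin k → X × A × ℝ) => f z.1 z.2) :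
    ∫⁻ ω, f (R.frozenObs (tau L.τ₁ (n + 1)) ω) (R.block (tau L.τ₁ (n + 1)) k ω) ∂P =
      ∫⁻ ω, ∫⁻ S, f (R.frozenObs (tau L.τ₁ (n + 1)) ω) S ∂Measure.pi (fun _ => E.sampleLaw
        (L.selKernel (R.frozenObs (tau L.τ₁ (n + 1)) ω) (n + 2))) ∂P := by
  set T := tau L.τ₁ (n + 1) with hT
  have hT1 : 1 ≤ T := by have := le_tau L.two_le_τ₁ (n + 1); omega
  have := E.isProb
  have hprob : ∀ d, IsProbabilityMeasure (E.sampleLaw (L.selKernel d (n + 2))) := fun d =>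
    isProbabilityMeasure_sampleLaw E _
  induction k with
  | zero =>
    congr 1
    funext ω
    rw [Measure.pi_of_empty, lintegral_dirac]
    congr 1
    exact Subsingleton.elim _ _
  | succ k ih =>
    have hlen : T + epochLen L.τ₁ (n + 2) = tau L.τ₁ (n + 2) := tau_add_epochLen L.τ₁ (n + 1)
    have hepoch : epochOf L.τ₁ (T + 1 + k) = n + 2 :=
      epochOf_eq L.two_le_τ₁ (by omega) (by change _ ≤ tau L.τ₁ (n + 2); omega)
    have hsnoc : Measurable fun z : ((ℕ → X × A × ℝ) × (Fin k → X × A × ℝ)) × X × A × ℝ =>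
        (Fin.snoc (α := fun _ => X × A × ℝ) z.1.2 z.2 : Fin (k + 1) → X × A × ℝ) := by
      refine measurable_pi_lambda _ fun l => ?_
      refine Fin.lastCases ?_ (fun l => ?_) l
      · simpa using measurable_snd
      · simp only [Fin.snoc_castSucc]
        exact (measurable_pi_apply l).comp (measurable_snd.comp measurable_fst)
    have hblock : ∀ ω, R.block T (k + 1) ω =
        Fin.snoc (α := fun _ => X × A × ℝ) (R.block T k ω) (R.obs ω (T + 1 + k)) := by
      intro ω
      funext l
      refine Fin.lastCases ?_ (fun l => ?_) l <;> simp [block]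
    have hfs : Measurable fun z : ((ℕ → X × A × ℝ) × (Fin k → X × A × ℝ)) × X × A × ℝ =>
        f z.1.1 (Fin.snoc (α := fun _ => X × A × ℝ) z.1.2 z.2) :=
      hf.comp ((measurable_fst.comp measurable_fst).prodMk hsnoc)
    have hhist : Measurable[R.past (T + 1 + k)] fun ω => (R.frozenObs T ω, R.block T k ω) := by
      refine Measurable.prodMk (R.measurable_frozenObs hT1 (by omega)) ?_
      refine @measurable_pi_lambda Ω (Fin k) (fun _ => X × A × ℝ) (R.past (T + 1 + k)) _ _
        fun l => ?_
      exact R.measurable_past_obs (by omega) (by omega)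
    -- The last observation is integrated out given the frozen stream and the first `k`
    -- observations. The result is a function of these alone, to which the induction hypothesis
    -- applies.
    have hround := R.lintegral_round (t := T + 1 + k) (by omega) hhist
      (q := fun z => L.selProb z.1 (n + 2))
      (fun b => (L.measurable_selProb (n + 2) b).comp
        ((measurable_fst.comp measurable_fst).prodMk measurable_snd))
      (fun ω => by rw [hepoch]; exact (R.selProb_frozenObs (m := n + 2) le_rfl ω).symm)
      (f := fun z y => f z.1 (Fin.snoc (α := fun _ => X × A × ℝ) z.2 y)) hfs
    simp only [hblock]
    rw [hround]
    have hg : Measurable fun z : (ℕ → X × A × ℝ) × (Fin k → X × A × ℝ) =>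
        ∫⁻ y, ∑ b, ENNReal.ofReal (L.selProb z.1 (n + 2) y.1 b) *
          f z.1 (Fin.snoc (α := fun _ => X × A × ℝ) z.2 (y.1, b, y.2 b)) ∂E.law := by
      refine Measurable.lintegral_prod_right' (f := fun w :
        ((ℕ → X × A × ℝ) × (Fin k → X × A × ℝ)) × X × (A → ℝ) =>
        ∑ b, ENNReal.ofReal (L.selProb w.1.1 (n + 2) w.2.1 b) *
          f w.1.1 (Fin.snoc (α := fun _ => X × A × ℝ) w.1.2 (w.2.1, b, w.2.2 b))) ?_
      refine Finset.measurable_fun_sum _ fun b _ => ?_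
      refine ((L.measurable_selProb (n + 2) b).comp ((measurable_fst.comp measurable_fst).prodMk
        (measurable_fst.comp measurable_snd))).ennreal_ofReal.mul ?_
      exact hfs.comp (measurable_fst.prodMk ((measurable_fst.comp measurable_snd).prodMk
        (measurable_const.prodMk
          ((measurable_pi_apply b).comp (measurable_snd.comp measurable_snd)))))
    rw [ih (by omega) (f := fun d S => ∫⁻ y, ∑ b, ENNReal.ofReal (L.selProb d (n + 2) y.1 b) *
          f d (Fin.snoc (α := fun _ => X × A × ℝ) S (y.1, b, y.2 b)) ∂E.law) hg]
    congr 1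
    funext ω
    have hfd : Measurable (f (R.frozenObs T ω)) := hf.comp (measurable_const.prodMk measurable_id)
    rw [lintegral_pi_succ_last _ hfd]
    congr 1
    funext S
    rw [lintegral_sampleLaw E (L.selProb_nonneg _ _) (L.sum_selProb _ _)]
    exact hfs.comp ((measurable_const (a := (R.frozenObs T ω, S))).prodMk measurable_id)

/-- The estimation oracle along the run. -/
lemma measure_predErr_gt_le {F : ℕ → Set (X → A → ℝ)} {C₀ : ℝ}
    (hF : ∀ i ∈ Finset.Icc 1 L.M, IsModelClass (F i)) (hC₀ : 0 ≤ C₀)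
    (hest : L.EstGuarantee E F C₀) {m : ℕ} (hm : 2 ≤ m) :
    P {ω | ¬ ∀ k ∈ Finset.Icc 1 L.M, ∫ x, L.predErr E (R.obs ω) m x ∂E.ctxLaw ≤
      C₀ * E.maxMisspec (F k) + L.rate k m} ≤ ENNReal.ofReal (L.δ / (4 * (m : ℝ) ^ 2)) := by
  obtain ⟨n, rfl⟩ := Nat.exists_eq_add_of_le' hm
  set T := tau L.τ₁ (n + 1) with hT
  set N := epochLen L.τ₁ (n + 2) with hN
  have hprob : ∀ d, IsProbabilityMeasure (E.sampleLaw (L.selKernel d (n + 2))) := fun d =>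
    isProbabilityMeasure_sampleLaw E _
  let e : (ℕ → X × A × ℝ) × (Fin N → X × A × ℝ) → ℝ := fun z =>
    ∫ x, ∑ b, L.selProb z.1 (n + 2) x b * (L.est N z.2 x b - E.fstar x b) ^ 2 ∂E.ctxLaw
  have he : Measurable e := by
    refine (StronglyMeasurable.integral_prod_right' (f := fun w :
      ((ℕ → X × A × ℝ) × (Fin N → X × A × ℝ)) × X => ∑ b, L.selProb w.1.1 (n + 2) w.2 b *
        (L.est N w.1.2 w.2 b - E.fstar w.2 b) ^ 2) ?_).measurable
    refine (Finset.measurable_fun_sum _ fun b _ => ?_).stronglyMeasurable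
    refine ((L.measurable_selProb (n + 2) b).comp
      ((measurable_fst.comp measurable_fst).prodMk measurable_snd)).mul ?_
    exact (((measurable_pi_apply b).comp ((L.est_measurable N).comp
      ((measurable_snd.comp measurable_fst).prodMk measurable_snd))).sub
      (((measurable_pi_apply b).comp E.fstar_measurable).comp measurable_snd)).pow_const 2
  -- A measurable set whose sections contain the events of the oracle. The misspecification error
  -- under the random kernel is replaced by its supremum over all kernels, which is deterministic.
  let good : Set ((ℕ → X × A × ℝ) × (Fin N → X × A × ℝ)) :=
    {z | ∀ k ∈ Finset.Icc 1 L.M, e z ≤ C₀ * E.maxMisspec (F k) + L.rate k (n + 2)}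
  have hgood : MeasurableSet good := by
    have : good = ⋂ k ∈ Finset.Icc 1 L.M,
        {z | e z ≤ C₀ * E.maxMisspec (F k) + L.rate k (n + 2)} := by
      ext z; simp [good]
    rw [this]
    exact Finset.measurableSet_biInter _ fun k _ => measurableSet_le he measurable_const
  have hζ0 : 0 < L.δ / (4 * ((n + 2 : ℕ) : ℝ) ^ 2) := by
    have := L.δ_pos
    positivity
  have hζ1 : L.δ / (4 * ((n + 2 : ℕ) : ℝ) ^ 2) < 1 := by
    have h1 := L.δ_lt_one
    rw [div_lt_one (by positivity)]
    have : (1 : ℝ) ≤ ((n + 2 : ℕ) : ℝ) ^ 2 := 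
      one_le_pow₀ (by exact_mod_cast (by omega : 1 ≤ n + 2))
    linarith
  set ζ := L.δ / (4 * ((n + 2 : ℕ) : ℝ) ^ 2) with hζ
  -- The oracle divides its level by `M`, so level `δ / (4 m²)` evaluates the rates exactly at `conf
  -- m`.
  have hconf : ζ / L.M = L.conf (n + 2) := by
    have hM : (0 : ℝ) < L.M := by exact_mod_cast L.one_le_M
    rw [hζ, Learner.conf]; field_simp
  have hbad : ∀ d, Measure.pi (fun _ : Fin N => E.sampleLaw (L.selKernel d (n + 2)))
      {S | (d, S) ∈ goodᶜ} ≤ ENNReal.ofReal ζ := by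
    intro d
    have h1 := hest (L.selKernel d (n + 2)) inferInstance N
      (two_le_epochLen L.two_le_τ₁ (by omega)) ζ hζ0 hζ1
    have h2 : MeasurableSet {S | (d, S) ∈ good} :=
      (measurable_const.prodMk measurable_id) hgood
    have h3 := h1.trans (measure_mono (t := {S | (d, S) ∈ good}) fun S hS k hk => by
      have h4 := hS k hk
      rw [sqErr_weightKernel E (L.selProb_nonneg d (n + 2)), hconf] at h4
      have h5 := E.misspec_le_maxMisspec (hF k hk) (L.selKernel d (n + 2))
      have h6 := mul_le_mul_of_nonneg_left h5 hC₀
      exact h4.trans (add_le_add_left h6 _))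
    have h4 : {S | (d, S) ∈ goodᶜ} = {S | (d, S) ∈ good}ᶜ := rfl
    rw [h4, prob_compl_eq_one_sub h2]
    refine (tsub_le_tsub_left h3 1).trans ?_
    rw [← ENNReal.ofReal_one, ← ENNReal.ofReal_sub _ (by linarith)]
    simp
  have hset : {ω | ¬ ∀ k ∈ Finset.Icc 1 L.M, ∫ x, L.predErr E (R.obs ω) (n + 2) x ∂E.ctxLaw ≤
      C₀ * E.maxMisspec (F k) + L.rate k (n + 2)} =
      (fun ω => (R.frozenObs T ω, R.block T N ω)) ⁻¹' goodᶜ := by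
    ext ω
    have h1 : e (R.frozenObs T ω, R.block T N ω) =
        ∫ x, L.predErr E (R.obs ω) (n + 2) x ∂E.ctxLaw := by
      have h2 : L.selProb (R.frozenObs T ω) (n + 2) = L.selProb (R.obs ω) (n + 2) :=
        R.selProb_frozenObs (m := n + 2) le_rfl ω
      simp only [e, Learner.predErr, h2]
      rfl
    simp only [Set.mem_ofPred_eq, Set.mem_preimage, Set.mem_compl_iff, good, h1]
  have hT1 : 1 ≤ T := by have := le_tau L.two_le_τ₁ (n + 1); omega
  have hfm : Measurable fun ω => (R.frozenObs T ω, R.block T N ω) := by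
    refine ((R.measurable_frozenObs hT1 (Nat.lt_succ_self T)).mono (R.past_le _) le_rfl).prodMk ?_
    exact measurable_pi_lambda _ fun l => (measurable_pi_apply _).comp R.measurable_obs
  have hblock := R.lintegral_block (n := n) (k := N) le_rfl
    (f := fun d S => goodᶜ.indicator 1 (d, S)) (measurable_one.indicator hgood.compl)
  rw [hset, ← lintegral_indicator_one (hfm hgood.compl)]
  calc ∫⁻ ω, ((fun ω => (R.frozenObs T ω, R.block T N ω)) ⁻¹' goodᶜ).indicator 1 ω ∂P
      = ∫⁻ ω, ∫⁻ S, goodᶜ.indicator 1 (R.frozenObs T ω, S) ∂Measure.pi (fun _ => E.sampleLaw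
        (L.selKernel (R.frozenObs T ω) (n + 2))) ∂P := hblock
    _ ≤ ∫⁻ _, ENNReal.ofReal ζ ∂P := by
        refine lintegral_mono fun ω => ?_
        have h2 : MeasurableSet {S | (R.frozenObs T ω, S) ∈ goodᶜ} :=
          (measurable_const.prodMk measurable_id) hgood.compl
        refine le_trans (le_of_eq ?_) (hbad (R.frozenObs T ω))
        rw [← lintegral_indicator_one h2]
        rfl
    _ = ENNReal.ofReal ζ := by simp

end Run

end ModIGW

end

namespace ModIGW

/-! ### Concentration of the regret and correctness of the tests. -/

namespace Run

variable {X A Ω : Type*} [MeasurableSpace X] [MeasurableSpace A] [Fintype A]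
  [MeasurableSpace Ω] {E : Environment X A} {L : Learner X A} {P : Measure Ω}
  (R : Run E L P) [MeasurableSingletonClass A]

variable (E L) in
lemma measurable_gap_uncurry : Measurable fun z : X × A => gap E L z.1 z.2 :=
  measurable_from_prod_countable_left fun b => measurable_gap E L b

variable [Nonempty A] [IsProbabilityMeasure P]

/-- The conditional expectation of the regret of round `t` given the past. -/
lemma integral_mul_gap {t : ℕ} (ht : 2 ≤ t) {W : Ω → ℝ} (hW : Measurable[R.past t] W)
    (hW0 : ∀ ω, 0 ≤ W ω) :
    ∫ ω, W ω * gap E L (R.x t ω) (R.a t ω) ∂P =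
      ∫ ω, W ω * L.epochRegret E (R.obs ω) (epochOf L.τ₁ t) ∂P := by
  have := E.isProb
  set m := epochOf L.τ₁ t with hm
  have htau : tau L.τ₁ (m - 1) ≤ t - 1 := by
    have : tau L.τ₁ (m - 1) < t := tau_epochOf_lt L.two_le_τ₁ (by omega)
    omega
  have hW' : Measurable W := hW.mono (R.past_le t) le_rfl
  have hgap : Measurable fun ω => gap E L (R.x t ω) (R.a t ω) :=
    (measurable_gap_uncurry E L).comp ((R.x_measurable t).prodMk (R.a_measurable t))
  have hreg : Measurable fun ω => L.epochRegret E (R.obs ω) m :=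
    (L.measurable_epochRegret E m).comp R.measurable_obs
  have hg0 : ∀ x b, 0 ≤ gap E L x b := fun x b => (gap_mem_Icc E L x b).1
  have hround := R.lintegral_round (t := t) (by omega)
    (hW.prodMk (R.measurable_frozenObs (T := t - 1) (by omega) (by omega)))
    (q := fun z => L.selProb z.2 m)
    (fun b => (L.measurable_selProb m b).comp
      ((measurable_snd.comp measurable_fst).prodMk measurable_snd))
    (fun ω => (R.selProb_frozenObs htau ω).symm)
    (f := fun z y => ENNReal.ofReal (z.1 * gap E L y.1 y.2.1))
    ((measurable_fst.comp measurable_fst).mul ((measurable_gap_uncurry E L).comp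
      ((measurable_fst.comp measurable_snd).prodMk
        (measurable_fst.comp (measurable_snd.comp measurable_snd))))).ennreal_ofReal
  rw [integral_eq_lintegral_of_nonneg_ae
      (ae_of_all _ fun ω => mul_nonneg (hW0 ω) (hg0 _ _)) (hW'.mul hgap).aestronglyMeasurable,
    integral_eq_lintegral_of_nonneg_ae
      (ae_of_all _ fun ω => mul_nonneg (hW0 ω) (Learner.epochRegret_nonneg _))
      (hW'.mul hreg).aestronglyMeasurable]
  congr 1
  refine hround.trans ?_
  congr 1
  funext ω
  simp only [R.selProb_frozenObs htau ω]
  have hsum : ∀ x, ∑ b, ENNReal.ofReal (L.selProb (R.obs ω) m x b) *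
      ENNReal.ofReal (W ω * gap E L x b) =
      ENNReal.ofReal (W ω * ∑ b, L.selProb (R.obs ω) m x b * gap E L x b) := by
    intro x
    rw [Finset.mul_sum, ENNReal.ofReal_sum_of_nonneg fun b _ =>
      mul_nonneg (hW0 ω) (mul_nonneg (L.selProb_nonneg _ _ _ _) (hg0 _ _))]
    refine Finset.sum_congr rfl fun b _ => ?_
    rw [← ENNReal.ofReal_mul (L.selProb_nonneg _ _ _ _)]
    ring_nf
  have hmeas : Measurable fun x => ENNReal.ofReal
      (W ω * ∑ b, L.selProb (R.obs ω) m x b * gap E L x b) :=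
    (((L.measurable_regret_integrand E m).comp
      (measurable_const.prodMk measurable_id)).const_mul _).ennreal_ofReal
  simp only [hsum]
  rw [← lintegral_map (μ := E.law) hmeas measurable_fst, Learner.epochRegret,
    ← integral_const_mul, ofReal_integral_eq_lintegral_ofReal]
  · rfl
  · exact (Learner.integrable_regret_integrand m).const_mul _
  · exact ae_of_all _ fun x => mul_nonneg (hW0 ω)
      (L.sum_selProb_mul_mem_Icc _ m (gap_mem_Icc E L x) x).1

/-- The regret is close to the sum of its conditional expectations. -/
lemma measure_deviation_gt_le {m : ℕ} (hm : 1 ≤ m) :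
    P {ω | ¬ ∀ t ≤ tau L.τ₁ m, ∑ s ∈ Finset.Icc (L.τ₁ + 1) t,
      (gap E L (R.x s ω) (R.a s ω) - L.epochRegret E (R.obs ω) (epochOf L.τ₁ s)) ≤
        √(2 * tau L.τ₁ m * Real.log (1 / L.conf m))} ≤ ENNReal.ofReal (L.conf m) := by
  have hτ := L.two_le_τ₁
  have hN : 0 < tau L.τ₁ m := by have := le_tau hτ m; omega
  have hN' : (0 : ℝ) < tau L.τ₁ m := by exact_mod_cast hN
  have hc := L.conf_pos hm
  have hlog : 0 ≤ Real.log (1 / L.conf m) :=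
    Real.log_nonneg (by rw [le_div_iff₀ hc]; linarith [L.conf_lt_one hm])
  have hgap : ∀ t, Measurable fun ω => gap E L (R.x t ω) (R.a t ω) := fun t =>
    (measurable_gap_uncurry E L).comp ((R.x_measurable t).prodMk (R.a_measurable t))
  have hreg : ∀ n, Measurable fun ω => L.epochRegret E (R.obs ω) n := fun n =>
    (L.measurable_epochRegret E n).comp R.measurable_obs
  -- The differences start at round `τ₁ + 1`, where a frozen stream with `T ≥ 1` is available; the
  -- first epoch is charged to the summand `τ₁` in `regret_le_add`.
  have h := measure_exists_sum_gt_le (P := P) (fun s => R.past (L.τ₁ + 1 + s))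
    (fun s => R.past_le _) (fun s s' hs => R.past_mono (by omega))
    (fun s ω => gap E L (R.x (L.τ₁ + 1 + s) ω) (R.a (L.τ₁ + 1 + s) ω) -
      L.epochRegret E (R.obs ω) (epochOf L.τ₁ (L.τ₁ + 1 + s)))
    (fun s => by
      have hlt : L.τ₁ + 1 + s < L.τ₁ + 1 + (s + 1) := by omega
      have h1 := R.measurable_past_triple (s := L.τ₁ + 1 + s) (by omega) hlt
      have h2 : Measurable fun z : X × (A → ℝ) × A => gap E L z.1 z.2.2 :=
        (measurable_gap_uncurry E L).comp
          (measurable_fst.prodMk (measurable_snd.comp measurable_snd))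
      have h3 := (L.measurable_epochRegret E (epochOf L.τ₁ (L.τ₁ + 1 + s))).comp
        (R.measurable_frozenObs (T := L.τ₁ + s) (by omega)
          (by omega : _ < L.τ₁ + 1 + (s + 1)))
      refine Measurable.sub (h2.comp h1) ?_
      convert h3 using 1
      funext ω
      have htau : tau L.τ₁ (epochOf L.τ₁ (L.τ₁ + 1 + s) - 1) ≤ L.τ₁ + s := by
        have := tau_epochOf_lt hτ (t := L.τ₁ + 1 + s) (by omega)
        omega
      simp only [Function.comp, Learner.epochRegret, R.selProb_frozenObs htau ω])
    (fun s ω => by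
      have h1 := gap_mem_Icc E L (R.x (L.τ₁ + 1 + s) ω) (R.a (L.τ₁ + 1 + s) ω)
      have h2 := Learner.epochRegret_nonneg (L := L) (E := E) (d := R.obs ω)
        (epochOf L.τ₁ (L.τ₁ + 1 + s))
      have h3 := Learner.epochRegret_le_one (L := L) (E := E) (d := R.obs ω)
        (epochOf L.τ₁ (L.τ₁ + 1 + s))
      exact abs_le.mpr ⟨by linarith [h1.1], by linarith [h1.2]⟩)
    (fun s W hW hW0 ⟨c, hWc⟩ => by
      have hW' : Measurable W := hW.mono (R.past_le _) le_rfl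
      have hint : ∀ Z : Ω → ℝ, Measurable Z → (∀ ω, Z ω ∈ Set.Icc (0 : ℝ) 1) →
          Integrable (fun ω => W ω * Z ω) P := fun Z hZ hZ1 =>
        Integrable.of_mem_Icc 0 c (hW'.mul hZ).aemeasurable (ae_of_all _ fun ω =>
          ⟨mul_nonneg (hW0 ω) (hZ1 ω).1,
            (mul_le_of_le_one_right (hW0 ω) (hZ1 ω).2).trans (hWc ω)⟩)
      simp only [mul_sub]
      rw [integral_sub (hint _ (hgap _) fun ω => gap_mem_Icc E L _ _)
        (hint _ (hreg _) fun ω => ⟨Learner.epochRegret_nonneg _, Learner.epochRegret_le_one _⟩),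
        R.integral_mul_gap (by omega) hW hW0, sub_self])
    hN (Real.sqrt_nonneg (2 * tau L.τ₁ m * Real.log (1 / L.conf m)))
  rw [Real.sq_sqrt (by positivity), mul_div_cancel_left₀ _ (by positivity), one_div,
    Real.log_inv, neg_neg, Real.exp_log hc] at h
  refine (measure_mono fun ω hω => ?_).trans h
  simp only [Set.mem_ofPred_eq, not_forall, not_le] at hω
  obtain ⟨t, ht, hlt⟩ := hω
  refine ⟨t - L.τ₁, by omega, ?_⟩
  have hIcc : Finset.Icc (L.τ₁ + 1) t = Finset.Ico (L.τ₁ + 1) (t + 1) := by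
    ext s; simp only [Finset.mem_Icc, Finset.mem_Ico]; omega
  rw [hIcc, Finset.sum_Ico_eq_sum_range, Nat.add_sub_add_right, one_div, Real.log_inv] at hlt
  exact hlt

omit [Nonempty A] in
/-- The misspecification tests along the run. -/
lemma measure_test_fails_le {F : ℕ → Set (X → A → ℝ)} {C₀ : ℝ} {β' : ℕ → ℝ} {β : ℕ → ℝ≥0∞}
    (hMT : R.MTGuarantee F C₀ β' β) {i : ℕ} (hi : i ∈ Finset.Icc 1 L.M) {m : ℕ} (hm : 1 ≤ m) :
    P {ω | ¬ (((tau L.τ₁ m : ℝ≥0∞) ≤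
        ENNReal.ofReal (β' i) * tauTop L.τ₁ (L.safeEpoch E F C₀ i) →
        L.mt i _ (L.epochData (R.obs ω) m) (L.conf m) = false) ∧
      (β i < (tau L.τ₁ m : ℝ≥0∞) → L.mt i _ (L.epochData (R.obs ω) m) (L.conf m) = true))} ≤
      ENNReal.ofReal (L.conf m) := by
  have hmeas : ∀ v : Bool,
      MeasurableSet {ω | L.mt i _ (L.epochData (R.obs ω) m) (L.conf m) = v} := fun v =>
    ((L.mt_measurable i _ (L.conf m)).comp ((L.measurable_epochData m).comp R.measurable_obs))
      (measurableSet_singleton v)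
  have hcompl : ∀ v : Bool, ENNReal.ofReal (1 - L.conf m) ≤
      P {ω | L.mt i _ (L.epochData (R.obs ω) m) (L.conf m) = v} →
      P {ω | L.mt i _ (L.epochData (R.obs ω) m) (L.conf m) = v}ᶜ ≤
        ENNReal.ofReal (L.conf m) := by
    intro v hv
    rw [prob_compl_eq_one_sub (hmeas v)]
    refine (tsub_le_tsub_left hv 1).trans ?_
    rw [← ENNReal.ofReal_one, ← ENNReal.ofReal_sub _ (by linarith [L.conf_lt_one hm])]
    simp
  -- By `beta_gt` the accepting and the rejecting regime exclude each other, so one failure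
  -- probability covers both.
  by_cases hacc : (tau L.τ₁ m : ℝ≥0∞) ≤
      ENNReal.ofReal (β' i) * tauTop L.τ₁ (L.safeEpoch E F C₀ i)
  · have hrej : ¬ β i < (tau L.τ₁ m : ℝ≥0∞) := by
      rw [not_lt]
      rcases hMT.beta_gt i hi with h | h
      · exact hacc.trans h.le
      · exact h ▸ le_top
    refine (measure_mono fun ω hω => ?_).trans
      (hcompl false (hMT.accepts i hi m hm _ (L.conf_pos hm) (L.conf_lt_one hm) hacc))
    exact fun h => hω ⟨fun _ => h, fun h' => absurd h' hrej⟩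
  · by_cases hrej : β i < (tau L.τ₁ m : ℝ≥0∞)
    · refine (measure_mono fun ω hω => ?_).trans
        (hcompl true (hMT.rejects i hi m hm _ (L.conf_pos hm) (L.conf_lt_one hm) hrej))
      exact fun h => hω ⟨fun h' => absurd h' hacc, fun _ => h⟩
    · simp [hacc, hrej]

end Run

/-- Epochs 1 and 2 need only their tests, later epochs also the estimate and the deviation. Three
events in every epoch would give `(3/4) * π²/6 > 1`. With the omission, `1/m² ≤ 1/(m-1) - 1/m` for
`m ≥ 3` bounds the sum by `5/16 + 3/8 = 11/16`. -/
lemma sum_range_failure_weights_le (n : ℕ) :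
    ∑ k ∈ Finset.range n, (if k < 2 then 1 else 3) / (4 * ((k + 1 : ℕ) : ℝ) ^ 2) ≤ 1 := by
  have h : ∀ n : ℕ, ∑ k ∈ Finset.range (n + 2),
      (if k < 2 then 1 else 3) / (4 * ((k + 1 : ℕ) : ℝ) ^ 2) ≤ 11 / 16 - 3 / 4 / ((n : ℝ) + 2) := by
    intro n
    induction n with
    | zero => norm_num [Finset.sum_range_succ]
    | succ n ih =>
      rw [Finset.sum_range_succ, if_neg (by omega)]
      have h1 : (3 : ℝ) / (4 * ((n + 2 + 1 : ℕ) : ℝ) ^ 2) ≤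
          3 / 4 / ((n : ℝ) + 2) - 3 / 4 / ((n : ℝ) + 3) := by
        have hn : (0 : ℝ) ≤ n := Nat.cast_nonneg n
        rw [div_sub_div _ _ (by positivity) (by positivity),
          div_le_div_iff₀ (by positivity) (by positivity)]
        push_cast
        nlinarith
      have h2 : ((n + 1 : ℕ) : ℝ) + 2 = n + 3 := by push_cast; ring
      rw [h2]
      linarith
  have hmono : ∑ k ∈ Finset.range n, (if k < 2 then 1 else 3) / (4 * ((k + 1 : ℕ) : ℝ) ^ 2) ≤
      ∑ k ∈ Finset.range (n + 2), (if k < 2 then 1 else 3) / (4 * ((k + 1 : ℕ) : ℝ) ^ 2) := by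
    refine Finset.sum_le_sum_of_subset_of_nonneg (Finset.range_mono (by omega)) fun k _ _ => ?_
    split_ifs <;> positivity
  have h3 : 0 ≤ 3 / 4 / ((n : ℝ) + 2) := by positivity
  linarith [h n]

end ModIGW

/-! ### The union bound over all epochs. -/

theorem theorem7 :
    ∃ C : ℝ, 0 < C ∧
      ∀ (X A Ω : Type*) [MeasurableSpace X] [Fintype A] [Nonempty A] [MeasurableSpace A]
        [MeasurableSingletonClass A] [MeasurableSpace Ω]
        (P : Measure Ω) [IsProbabilityMeasure P]
        (E : ModIGW.Environment X A) (L : ModIGW.Learner X A) (R : ModIGW.Run E L P)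
        (F : ℕ → Set (X → A → ℝ)) (C₀ : ℝ) (β' : ℕ → ℝ) (β : ℕ → ℝ≥0∞),
        (∀ i ∈ Finset.Icc 1 L.M, ModIGW.IsModelClass (F i)) →
        1 ≤ C₀ →
        L.ValidRates →
        L.EstGuarantee E F C₀ →
        R.MTGuarantee F C₀ β' β →
        ENNReal.ofReal (1 - L.δ) ≤ P {ω |
          ∀ i ∈ Finset.Icc 1 L.M, ∀ j ∈ Finset.Icc 1 L.M, β (j - 1) ≠ ⊤ →
          ∀ t : ℕ, 1 ≤ t →
            (t : ℝ≥0∞) ≤ ENNReal.ofReal (β' i) *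
              ModIGW.tauTop L.τ₁ (L.safeEpoch E F C₀ i) →
            max (R.regret t ω) (R.expRegret t ω) ≤
              C * (L.τ₁ + (β (j - 1)).toReal * L.logFactor (β (j - 1)).toReal i j +
                L.rateSum i j t)} := by
  refine ⟨200, by norm_num, ?_⟩
  intro X A Ω _ _ _ _ _ _ P _ E L R F C₀ β' β hF hC₀ hL hest hMT
  set G := {ω | ∀ i ∈ Finset.Icc 1 L.M, ∀ j ∈ Finset.Icc 1 L.M, β (j - 1) ≠ ⊤ →
    ∀ t : ℕ, 1 ≤ t → (t : ℝ≥0∞) ≤ ENNReal.ofReal (β' i) *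
      ModIGW.tauTop L.τ₁ (L.safeEpoch E F C₀ i) →
    max (R.regret t ω) (R.expRegret t ω) ≤ 200 * (L.τ₁ + (β (j - 1)).toReal *
      L.logFactor (β (j - 1)).toReal i j + L.rateSum i j t)} with hG
  let badEst : ℕ → Set Ω := fun m => {ω | ¬ ∀ k ∈ Finset.Icc 1 L.M,
    ∫ x, L.predErr E (R.obs ω) m x ∂E.ctxLaw ≤ C₀ * E.maxMisspec (F k) + L.rate k m}
  let badDev : ℕ → Set Ω := fun m => {ω | ¬ ∀ t ≤ ModIGW.tau L.τ₁ m,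
    ∑ s ∈ Finset.Icc (L.τ₁ + 1) t, (ModIGW.Run.gap E L (R.x s ω) (R.a s ω) -
      L.epochRegret E (R.obs ω) (ModIGW.epochOf L.τ₁ s)) ≤
        √(2 * ModIGW.tau L.τ₁ m * Real.log (1 / L.conf m))}
  let badTest : ℕ → ℕ → Set Ω := fun m i => {ω | ¬ (((ModIGW.tau L.τ₁ m : ℝ≥0∞) ≤
      ENNReal.ofReal (β' i) * ModIGW.tauTop L.τ₁ (L.safeEpoch E F C₀ i) →
      L.mt i _ (L.epochData (R.obs ω) m) (L.conf m) = false) ∧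
    (β i < (ModIGW.tau L.τ₁ m : ℝ≥0∞) →
      L.mt i _ (L.epochData (R.obs ω) m) (L.conf m) = true))}
  -- `bad k` belongs to epoch `k + 1`, so `k < 2` singles out epochs 1 and 2.
  let bad : ℕ → Set Ω := fun k => (⋃ i ∈ Finset.Icc 1 L.M, badTest (k + 1) i) ∪
    if k < 2 then ∅ else badEst (k + 1) ∪ badDev (k + 1)
  have hδ := L.δ_pos
  have hM : (1 : ℝ) ≤ L.M := by exact_mod_cast L.one_le_M
  have hcover : Set.univ ⊆ G ∪ ⋃ k, bad k := by
    intro ω _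
    by_cases hω : ω ∈ ⋃ k, bad k
    · exact Or.inr hω
    · left
      have hω' : ∀ k, ω ∉ bad k := fun k hk => hω (Set.mem_iUnion.mpr ⟨k, hk⟩)
      have htest : ∀ i ∈ Finset.Icc 1 L.M, ∀ m, 1 ≤ m → ω ∉ badTest m i := by
        intro i hi m hm h
        obtain ⟨k, rfl⟩ := Nat.exists_eq_add_of_le' hm
        exact hω' k (Or.inl (Set.mem_biUnion hi h))
      have hrest : ∀ m, 3 ≤ m → ω ∉ badEst m ∪ badDev m := by
        intro m hm h
        obtain ⟨k, rfl⟩ := Nat.exists_eq_add_of_le' (show 1 ≤ m by omega)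
        refine hω' k (Or.inr ?_)
        rwa [if_neg (by omega)]
      intro i hi j hj hβ t ht htβ
      exact R.max_regret_le hL hMT
        (fun m hm => not_not.mp fun h => hrest m hm (Or.inl h))
        (fun i hi m hm => (not_not.mp (htest i hi m hm)).1)
        (fun i hi m hm => (not_not.mp (htest i hi m hm)).2)
        (fun m hm => not_not.mp fun h => hrest m hm (Or.inr h)) hi hj hβ ht htβ
  have hbad : ∀ k, P (bad k) ≤
      ENNReal.ofReal (L.δ * ((if k < 2 then 1 else 3) / (4 * ((k + 1 : ℕ) : ℝ) ^ 2))) := by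
    intro k
    set w : ℝ := L.δ / (4 * ((k + 1 : ℕ) : ℝ) ^ 2) with hw
    have hw0 : 0 ≤ w := by positivity
    have hMconf : L.M * L.conf (k + 1) = w := by
      rw [hw, ModIGW.Learner.conf]; field_simp
    have hconf : L.conf (k + 1) ≤ w := by
      rw [← hMconf]
      exact le_mul_of_one_le_left (L.conf_pos (by omega)).le hM
    have h1 : P (⋃ i ∈ Finset.Icc 1 L.M, badTest (k + 1) i) ≤ ENNReal.ofReal w := by
      refine (measure_biUnion_finset_le _ _).trans ?_
      refine (Finset.sum_le_sum fun i hi =>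
        R.measure_test_fails_le hMT hi (m := k + 1) (by omega)).trans ?_
      rw [Finset.sum_const, Nat.card_Icc, Nat.add_sub_cancel, ← ENNReal.ofReal_nsmul,
        nsmul_eq_mul, hMconf]
    refine (measure_union_le _ _).trans ?_
    split_ifs with hk
    · rw [measure_empty, add_zero, mul_one_div]
      exact h1
    · have h2 := R.measure_predErr_gt_le hF (by linarith) hest (m := k + 1) (by omega)
      have h3 := (R.measure_deviation_gt_le (m := k + 1) (by omega)).trans
        (ENNReal.ofReal_le_ofReal hconf)
      have h4 : L.δ * (3 / (4 * ((k + 1 : ℕ) : ℝ) ^ 2)) = w + (w + w) := by rw [hw]; ring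
      rw [h4, ENNReal.ofReal_add hw0 (by positivity), ENNReal.ofReal_add hw0 hw0]
      exact add_le_add h1 ((measure_union_le _ _).trans (add_le_add h2 h3))
  have hsum : P (⋃ k, bad k) ≤ ENNReal.ofReal L.δ := by
    refine (measure_iUnion_le _).trans ((ENNReal.tsum_le_tsum hbad).trans ?_)
    refine ENNReal.tsum_le_of_sum_range_le fun n => ?_
    rw [← ENNReal.ofReal_sum_of_nonneg fun k _ => by positivity, ← Finset.mul_sum]
    exact ENNReal.ofReal_le_ofReal
      (mul_le_of_le_one_right hδ.le (ModIGW.sum_range_failure_weights_le n))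
  rw [ENNReal.ofReal_sub _ hδ.le, ENNReal.ofReal_one, tsub_le_iff_right]
  calc (1 : ℝ≥0∞) = P Set.univ := measure_univ.symm
    _ ≤ P G + P (⋃ k, bad k) := (measure_mono hcover).trans (measure_union_le _ _)
    _ ≤ P G + ENNReal.ofReal L.δ := by gcongr
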